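/- Let $\mathbf k$ be an algebraically closed field and let $G=(V,E)$ be a finite simple connected graph with $n=|V|\ge 2$ vertices and $|E|=2n-2$ edges. **Definitions.** Fix a spanning tree $T_0$ of $G$, an orientation of each edge, and a bijection between $T_0$ and $E\setminus T_0$. For $e\in E\setminus T_0$ oriented from $v$ to $w$ and $f\in T_0$, let $c_{ef}\in\{0,1,-1\}$ be $1$ (resp. $-1$) if the path from $v$ to $w$ in $T_0$ traverses $f$ along (resp. against) its orientation, and $0$ if it does not contain $f$. The *tree polynomial* of $G$ is $$\tau(G)=\det M_{T_0}\in\mathbf k[m_e : e\in E],\qquad M_{T_0}=\bigl[c_{ef}\,(m_e-m_f)\bigr]_{e\in E\setminus T_0,\ f\in T_0};$$ it depends on the choices only up to sign, and everything below holds for every choice. A *coupled spanning tree* of $G$ is a set $T\subset E$ such that $T$ and $E\setminus T$ are both spanning trees of $G$; $\mathrm{Cpl}(G)$ is the set of these. A graph is a *rigidity pseudocircuit* if it is the edge-disjoint union of two spanning trees. $G$ is a *rigidity circuit* if $E$ is a minimal dependent set of the generic rigidity matroid, that is, of the algebraic dependence matroid over $\mathbb Q$ of the polynomials $(x_v-x_w)^2+(y_v-y_w)^2$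 attached to the pairs $vw$ of vertices. For $F\subset E$ put $m_F=\prod_{f\in F}m_f$. A *picture* $\mathbf P$ of $G$ consists of a point $\mathbf P(v)\in\mathbb P^2_{\mathbf k}$ for each vertex $v$ and a line $\mathbf P(e)\subset\mathbb P^2_{\mathbf k}$ for each edge $e$, with $\mathbf P(v)\in\mathbf P(e)$ whenever $v$ is an endpoint of $e$; it is *generic* if the points $\mathbf P(v)$ are pairwise distinct. The *picture variety* $\mathcal V(G)$ is the Zariski closure of the set of generic pictures in the product of the $\mathbb P^2$'s and dual $\mathbb P^2$'s. The *affine picture variety* $\tilde{\mathcal V}(G)$ is the set of those $\mathbf P\in\mathcal V(G)$ whose points all lie in the affine plane $\mathbb A^2\subset\mathbb P^2$ and none of whose lines is parallel to the $y$-axis; on it, $m_e$ is the slope of $\mathbf P(e)$. The *affine slope variety* $\tilde{\mathcal S}(G)\subset\mathbf k^E$ is the set of all slope vectors $(m_e)_{e\in E}$ of those $\mathbf P\in\mathcal V(G)$ none of whose lines is the line at infinity or has infinite slope. **Theorem.** 1. There are signs $\varepsilon(T)\in\{1,-1\}$, $T\in\mathrm{Cpl}(G)$, with $\varepsilon(E\setminus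 T)=(-1)^{n-1}\varepsilon(T)$ for all $T\in\mathrm{Cpl}(G)$ and $$\tau(G)=\sum_{T\in\mathrm{Cpl}(G)}\varepsilon(T)\,m_T .$$ 2. $\tau(G)$ vanishes on $\tilde{\mathcal V}(G)$ and on $\tilde{\mathcal S}(G)$. 3. $\tau(G)\ne 0$ if and only if $G$ is a rigidity pseudocircuit. 4. $\tau(G)$ is irreducible in $\mathbf k[m_e : e\in E]$ if and only if $G$ is a rigidity circuit. 5. If a subgraph $G'=(V',E')$ of $G$ is a rigidity pseudocircuit, then $\tau(G')$, regarded as an element of $\mathbf k[m_e : e\in E]$, divides $\tau(G)$. -/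

import Mathlib

open scoped Classical LinearAlgebra.Projectivization

noncomputable section

namespace GraphVariety

variable {V : Type*}

/-! ### Edge sets, spanning trees, coupled spanning trees -/

/-- The graph `(V, F)` attached to a set of edges `F ⊆ E(G)`; it keeps all vertices of `G`. -/
def edgeGraph {G : SimpleGraph V} (F : Finset G.edgeSet) : SimpleGraph V :=
  SimpleGraph.fromEdgeSet {e | ∃ f ∈ F, (f : Sym2 V) = e}

/-- An edge set `F ⊆ E(G)` is a spanning tree if `(V, F)` is a tree. -/
def IsSpanningTree {G : SimpleGraph V} (F : Finset G.edgeSet) : Prop :=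
  (edgeGraph F).IsTree

/-- `T` is a coupled spanning tree if both `T` and `E ∖ T` are spanning trees. -/
def IsCoupled [Fintype V] {G : SimpleGraph V} (T : Finset G.edgeSet) : Prop :=
  IsSpanningTree T ∧ IsSpanningTree Tᶜ

/-- The finite set `Cpl(G)` of coupled spanning trees of `G`. -/
def coupledTrees [Fintype V] (G : SimpleGraph V) : Finset (Finset G.edgeSet) :=
  Finset.univ.filter IsCoupled

/-- `G` is a rigidity pseudocircuit: its edge set is the disjoint union of the edge sets of two
spanning trees. -/
def IsRigidityPseudocircuit [Fintype V] (G : SimpleGraph V) : Prop :=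
  ∃ T : Finset G.edgeSet, IsCoupled T

/-! ### The generic rigidity matroid -/

/-- The squared length `(x_v - x_w)² + (y_v - y_w)²` of the pair `vw`, as a polynomial in the
coordinates `x_v = X (v, 0)`, `y_v = X (v, 1)`. -/
def squaredLength : Sym2 V → MvPolynomial (V × Fin 2) ℚ :=
  Sym2.lift ⟨fun v w =>
    (MvPolynomial.X (v, 0) - MvPolynomial.X (w, 0)) ^ 2
      + (MvPolynomial.X (v, 1) - MvPolynomial.X (w, 1)) ^ 2, fun _ _ => by ring⟩

/-- The length-rigidity matroid (2-dimensional generic rigidity matroid): the algebraic dependence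
matroid over `ℚ` of the squared lengths, on the edge set of the complete graph on `V`. -/
def lengthRigidityMatroid (V : Type*) : Matroid (Sym2 V) :=
  (AlgebraicIndependent.matroid ℚ (MvPolynomial (V × Fin 2) ℚ)).comapOn
    (⊤ : SimpleGraph V).edgeSet squaredLength

/-- `G` is a rigidity circuit: its edge set is a minimal dependent set of the rigidity matroid. -/
def IsRigidityCircuit (G : SimpleGraph V) : Prop :=
  (lengthRigidityMatroid V).IsCircuit G.edgeSet

/-! ### The tree polynomial -/

/-- A choice of orientation for each edge of `G`. -/
structure EdgeOrientation (G : SimpleGraph V) where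
  dart : G.edgeSet → G.Dart
  edge_dart : ∀ e, (dart e).edge = e

/-- A spanning tree of `G`, as a set of edges. -/
structure SpanningTree (G : SimpleGraph V) where
  edges : Finset G.edgeSet
  isSpanningTree : IsSpanningTree edges

/-- The unique path between two vertices inside a spanning tree. -/
def SpanningTree.path {G : SimpleGraph V} (T : SpanningTree G) (v w : V) :
    (edgeGraph T.edges).Walk v w :=
  (T.isSpanningTree.existsUnique_path v w).choose

/-- The ordered pairs `(v₁, v₂), (v₂, v₃), …` of consecutive vertices of a walk. -/
def steps {H : SimpleGraph V} {v w : V} (p : H.Walk v w) : List (V × V) :=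
  p.darts.map SimpleGraph.Dart.toProd

/-- The coefficient `c^T_{ef}`. For `e` oriented from `v` to `w`, the path from `v` to `w` in `T`
closed up by `e` backwards is the cycle `z_T(e) = -e + ∑_{f ∈ T} c^T_{ef} f`. So `c^T_{ef}` is `1` if
the path traverses `f` along its orientation, `-1` if it traverses `f` against it, `0` otherwise. -/
def cycleCoeff {G : SimpleGraph V} (T : SpanningTree G) (o : EdgeOrientation G)
    (e f : G.edgeSet) : ℤ :=
  ((steps (T.path (o.dart e).fst (o.dart e).snd)).count (o.dart f).toProd : ℤ)
    - ((steps (T.path (o.dart e).fst (o.dart e).snd)).count (o.dart f).toProd.swap : ℤ)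

variable (k : Type*) [Field k]

/-- The matrix `M_T = [c^T_{ef} (m_e - m_f)]`, rows `e ∈ E ∖ T`, columns `f ∈ T`, over
`R_G = k[m_e : e ∈ E]`. -/
def treeMatrix {G : SimpleGraph V} (T : SpanningTree G) (o : EdgeOrientation G) :
    Matrix {e // e ∉ T.edges} {f // f ∈ T.edges} (MvPolynomial G.edgeSet k) :=
  Matrix.of fun e f =>
    (cycleCoeff T o e f : MvPolynomial G.edgeSet k)
      * (MvPolynomial.X e.1 - MvPolynomial.X f.1)

/-- The tree polynomial `det M_T`. The spanning tree `T`, the orientation `o` and the matching `σ` of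
columns with rows (which makes `M_T` a square matrix) are choices, on which the polynomial depends
only up to sign. -/
def treePolynomial {G : SimpleGraph V} (T : SpanningTree G) (o : EdgeOrientation G)
    (σ : {f // f ∈ T.edges} ≃ {e // e ∉ T.edges}) : MvPolynomial G.edgeSet k :=
  ((treeMatrix k T o).submatrix σ id).det

/-- The squarefree monomial `m_F = ∏_{f ∈ F} m_f`. -/
def edgeMonomial {G : SimpleGraph V} (F : Finset G.edgeSet) : MvPolynomial G.edgeSet k :=
  ∏ f ∈ F, MvPolynomial.X f

/-! ### Pictures and slopes -/

/-- `Gr(G)`: a point of the projective plane for each vertex and of the dual projective plane for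
each edge. The line `[l₀ : l₁ : l₂]` is `{[a₀ : a₁ : a₂] | l₀ a₀ + l₁ a₁ + l₂ a₂ = 0}`. -/
abbrev Gr (G : SimpleGraph V) : Type _ :=
  V ⊕ G.edgeSet → ℙ k (Fin 3 → k)

/-- The picture space: `P(v)` lies on `P(e)` whenever `v` is an endpoint of `e`. -/
def pictureSpace (G : SimpleGraph V) : Set (Gr k G) :=
  {P | ∀ e : G.edgeSet, ∀ v ∈ (e : Sym2 V),
    Projectivization.orthogonal (P (Sum.inl v)) (P (Sum.inr e))}

/-- The generic pictures: the points `P(v)` are pairwise distinct. -/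
def genericPictures (G : SimpleGraph V) : Set (Gr k G) :=
  {P ∈ pictureSpace k G | Function.Injective fun v => P (Sum.inl v)}

variable {k}

/-- Multihomogeneity of multidegree `d`, for polynomials in one triple of homogeneous coordinates
`X (i, 0), X (i, 1), X (i, 2)` for each `i`. -/
def IsMultihomogeneous {I : Type*} (F : MvPolynomial (I × Fin 3) k) (d : I →₀ ℕ) : Prop :=
  F.IsWeightedHomogeneous (fun p : I × Fin 3 => Finsupp.single p.1 1) d

/-- A multihomogeneous polynomial vanishes at a point of a product of projective planes; the choice
of representatives does not matter. -/
def VanishesAt {I : Type*} (F : MvPolynomial (I × Fin 3) k) (P : I → ℙ k (Fin 3 → k)) : Prop :=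
  MvPolynomial.eval (fun p : I × Fin 3 => (P p.1).rep p.2) F = 0

/-- The Zariski closure of a subset of a product of projective planes: the common zeros of the
multihomogeneous polynomials that vanish on the subset. -/
def zariskiClosure {I : Type*} (A : Set (I → ℙ k (Fin 3 → k))) : Set (I → ℙ k (Fin 3 → k)) :=
  {P | ∀ (d : I →₀ ℕ) (F : MvPolynomial (I × Fin 3) k), IsMultihomogeneous F d →
    (∀ Q ∈ A, VanishesAt F Q) → VanishesAt F P}

variable (k)

/-- The picture variety: the closure of the set of generic pictures. -/
def pictureVariety (G : SimpleGraph V) : Set (Gr k G) :=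
  zariskiClosure (genericPictures k G)

variable {k}

/-- The point lies in the affine plane `a₀ ≠ 0`, with coordinates `x = a₁ / a₀`, `y = a₂ / a₀`. -/
def IsAffinePoint (p : ℙ k (Fin 3 → k)) : Prop := p.rep 0 ≠ 0

/-- The line `l₀ + l₁ x + l₂ y = 0` is of the form `y = m x + b`: it is neither the line at infinity
nor parallel to the `y`-axis. -/
def IsNonvertical (l : ℙ k (Fin 3 → k)) : Prop := l.rep 2 ≠ 0

/-- The slope `m = - l₁ / l₂` of the nonvertical line `l₀ + l₁ x + l₂ y = 0`. -/
def slope (l : ℙ k (Fin 3 → k)) : k := - l.rep 1 / l.rep 2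

/-- The slope coordinates `m_e` of a picture. -/
def slopes {G : SimpleGraph V} (P : Gr k G) : G.edgeSet → k := fun e => slope (P (Sum.inr e))

variable (k)

/-- The affine picture space: all points are affine and no line is parallel to the `y`-axis. -/
def affinePictureSpace (G : SimpleGraph V) : Set (Gr k G) :=
  {P ∈ pictureSpace k G | (∀ v, IsAffinePoint (P (Sum.inl v))) ∧
    ∀ e, IsNonvertical (P (Sum.inr e))}

/-- The affine picture variety. -/
def affinePictureVariety (G : SimpleGraph V) : Set (Gr k G) :=
  pictureVariety k G ∩ affinePictureSpace k G

/-- The affine slope variety: the slope vectors of the members of the picture variety none of whose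
lines is the line at infinity or has infinite slope. The points of the picture may be at infinity. -/
def affineSlopeVariety (G : SimpleGraph V) : Set (G.edgeSet → k) :=
  {m | ∃ P ∈ pictureVariety k G, (∀ e, IsNonvertical (P (Sum.inr e))) ∧ slopes P = m}

end GraphVariety

end

open GraphVariety

/-!
A *realization* of a slope vector `s ∈ k^E` is a pair of functions `x, y : V → k` such that every
edge `vw` of `G` satisfies `y w - y v = s e * (x w - x v)`; it is *trivial* if `x` is constant. The
proof rests on one observation: `τ(G)` vanishes at `s` if and only if `s` has a nontrivial
realization (`pairDet_one_eq_zero_iff`). Indeed the increments of `x` along the edges of the tree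
determine `x` up to a constant, `y` is then determined up to a constant by its increments along the
tree, and the matrix `M_T` at `s` says that `y` is also right on the remaining edges. The
observation holds over every field extension of `k`, and in the homogeneous version `pairDet` of the
determinant each line contributes its two homogeneous slope coordinates.

* *Expansion.* The polynomial is affine in each variable because `m_e` occurs in one row or one
  column only, and it is homogeneous of degree `n - 1`. So the coefficient of `m_S` is the value of
  the integral determinant at the indicator function of `S`. For these slopes a realization amounts
  to two functions `y` and `y - x`, constant on the components of `(V, E ∖ S)` and of `(V, S)`
  respectively. Hence the coefficient vanishes if one of these graphs is disconnected, that is, if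
  `S` is not coupled; if `S` is coupled, it is nonzero modulo every prime, thus `1` or `-1`
  (`treeSign_coupled`, `treePolynomial_eq_sum`).

* *Vanishing.* The homogenized determinant vanishes at the slopes of every generic picture all of
  whose points are affine. A projective change of coordinates with indeterminate coefficients
  brings any generic picture into this position; specializing the indeterminates to zero, the
  homogenized determinant vanishes on the generic pictures themselves
  (`pairDet_eq_zero_of_generic`), hence on their closure.

* *Divisibility.* If `G'` is a pseudocircuit, then `τ(G')` is squarefree as a multiaffine
  polynomial, and by the Nullstellensatz it divides `τ(G)` as soon as every zero of `τ(G')` is a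
  zero of `τ(G)`. Extending a realization of `G'` to one of `G` is a linear problem with as many
  equations as unknowns. If it is uniquely solvable, a nontrivial realization of `G'` extends to `G`;
  if not, `G` has a nontrivial realization that collapses `G'` to a point
  (`pairDet_eq_zero_of_subgraph`).

* *Irreducibility.* Both properties are equivalent to the sparsity condition `IsSparse`: every vertex
  set `U` with `2 ≤ |U| < n` spans at most `2|U| - 3` edges. A pseudocircuit that violates it
  contains an induced pseudocircuit on fewer vertices, hence has a proper factor. Conversely, if `G`
  is sparse then a count of transcendence degrees produces a realization with nonconstant abscissas
  and algebraically independent slopes on all edges but one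
  (`algebraicIndependent_coordSlope`), and then in a proper factorization each factor misses a
  variable, because `τ(G)` is multiaffine, so that none of them can be the relation between the
  slopes that `τ(G)` is. For the rigidity matroid, a quarter turn converts the differential of the
  slopes into that of the squared lengths, so that by the Jacobian criterion the squared lengths are
  independent too (`algebraicIndependent_squaredLength`); dependent sets are produced by counting
  coordinates modulo the Euclidean motions.
-/

namespace GraphVariety

variable {V : Type*} {G : SimpleGraph V}

/-! ### Trees, potentials and the cycle coefficients -/

theorem edgeGraph_adj {F : Finset G.edgeSet} {v w : V} :
    (edgeGraph F).Adj v w ↔ ∃ h : G.Adj v w, (⟨s(v, w), h⟩ : G.edgeSet) ∈ F := by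
  simp only [edgeGraph, SimpleGraph.fromEdgeSet_adj, Set.mem_ofPred_eq]
  constructor
  · rintro ⟨⟨⟨e, he⟩, hf, rfl⟩, hne⟩
    exact ⟨he, hf⟩
  · rintro ⟨h, hf⟩
    exact ⟨⟨_, hf, rfl⟩, h.ne⟩

theorem eq_of_preconnected {H : SimpleGraph V} (hH : H.Preconnected) {α : Type*} {y : V → α}
    (h : ∀ v w, H.Adj v w → y v = y w) (v w : V) : y v = y w := by
  obtain ⟨p⟩ := hH v w
  induction p with
  | nil => rfl
  | cons hadj _ ih => exact (h _ _ hadj).trans ih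

namespace EdgeOrientation

variable (o : EdgeOrientation G)

theorem mk_fst_snd (e : G.edgeSet) : s((o.dart e).fst, (o.dart e).snd) = (e : Sym2 V) :=
  o.edge_dart e

theorem dart_mk {v w : V} (h : G.Adj v w) :
    (o.dart ⟨s(v, w), h⟩).toProd = (v, w) ∨ (o.dart ⟨s(v, w), h⟩).toProd = (w, v) := by
  have := o.mk_fst_snd ⟨s(v, w), h⟩
  rw [Sym2.eq_iff] at this
  rcases this with ⟨h1, h2⟩ | ⟨h1, h2⟩
  · exact Or.inl (Prod.ext h1 h2)
  · exact Or.inr (Prod.ext h1 h2)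

theorem mk_eq_of_toProd {f : G.edgeSet} {v w : V} (h : G.Adj v w)
    (hf : (o.dart f).toProd = (v, w) ∨ (o.dart f).toProd = (w, v)) : f = ⟨s(v, w), h⟩ := by
  apply Subtype.ext
  rw [← o.mk_fst_snd f]
  rcases hf with hf | hf
  · simp [hf]
  · simp [hf, Sym2.eq_swap]

/-- The coboundary of a potential `y`: its increment along an oriented edge. -/
def diff {R : Type*} [Ring R] (y : V → R) (e : G.edgeSet) : R :=
  y (o.dart e).snd - y (o.dart e).fst

theorem diff_eq_mul_iff {R : Type*} [Ring R] {c : R} {x y : V → R} {v w : V} (h : G.Adj v w) :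
    o.diff y ⟨s(v, w), h⟩ = c * o.diff x ⟨s(v, w), h⟩ ↔ y w - y v = c * (x w - x v) := by
  rcases o.dart_mk h with h' | h' <;> simp only [diff, h']
  rw [← neg_sub (y w), ← neg_sub (x w), mul_neg, neg_inj]

theorem diff_ext_iff {R : Type*} [Ring R] {s : G.edgeSet → R} {x y : V → R} :
    (∀ e, o.diff y e = s e * o.diff x e) ↔
      ∀ v w (h : G.Adj v w), y w - y v = s ⟨s(v, w), h⟩ * (x w - x v) := by
  refine ⟨fun H v w h => (o.diff_eq_mul_iff h).1 (H _), fun H e => ?_⟩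
  obtain ⟨e, he⟩ := e
  induction e with | h v w => exact (o.diff_eq_mul_iff he).2 (H v w he)

theorem eq_of_diff_eq_zero {R : Type*} [Ring R] {F : Finset G.edgeSet}
    (hF : (edgeGraph F).Preconnected) {y : V → R} (h : ∀ f ∈ F, o.diff y f = 0) (v w : V) :
    y v = y w := by
  refine eq_of_preconnected hF (fun v w hvw => ?_) v w
  obtain ⟨ha, hm⟩ := edgeGraph_adj.1 hvw
  have := h _ hm
  rcases o.dart_mk ha with h' | h' <;> simp only [diff, h'] at this
  · exact (sub_eq_zero.1 this).symm
  · exact sub_eq_zero.1 this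

/-- The increments of a potential along the steps of a walk telescope; grouping the steps by edge
gives the signed count of the traversals of each edge. -/
theorem sum_count_mul_diff {R : Type*} [Ring R] {F : Finset G.edgeSet} (y : V → R)
    {a b : V} (p : (edgeGraph F).Walk a b) :
    ∑ f : {f // f ∈ F}, ((((steps p).count (o.dart f).toProd : ℤ)
      - ((steps p).count (o.dart f).toProd.swap : ℤ) : ℤ) : R) * o.diff y f = y b - y a := by
  induction p with
  | nil => simp [steps]
  | @cons u v w hadj p ih =>
    obtain ⟨ha, hm⟩ := edgeGraph_adj.1 hadj
    have key : ∀ f : {f // f ∈ F},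
        ((((steps (SimpleGraph.Walk.cons hadj p)).count (o.dart f).toProd : ℤ)
          - ((steps (SimpleGraph.Walk.cons hadj p)).count (o.dart f).toProd.swap : ℤ) : ℤ) : R)
          * o.diff y f
        = ((((steps p).count (o.dart f).toProd : ℤ)
          - ((steps p).count (o.dart f).toProd.swap : ℤ) : ℤ) : R) * o.diff y f
          + if f = ⟨⟨s(u, v), ha⟩, hm⟩ then y v - y u else 0 := by
      intro f
      have hs : steps (SimpleGraph.Walk.cons hadj p) = (u, v) :: steps p := rfl
      rw [hs, List.count_cons, List.count_cons]
      by_cases hf : f = ⟨⟨s(u, v), ha⟩, hm⟩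
      · subst hf
        have hne : (u, v) ≠ (v, u) := fun h => ha.ne (congrArg Prod.fst h)
        rcases o.dart_mk ha with h' | h'
        · simp only [diff, h', Prod.swap_prod_mk, beq_iff_eq, hne, if_true, if_false]
          push_cast
          noncomm_ring
        · simp only [diff, h', Prod.swap_prod_mk, beq_iff_eq, hne, if_true, if_false]
          push_cast
          noncomm_ring
      · have h1 : (u, v) ≠ (o.dart f).toProd := fun h =>
          hf (Subtype.ext (o.mk_eq_of_toProd ha (Or.inl h.symm)))
        have h2 : (u, v) ≠ (o.dart f).toProd.swap := fun h =>
          hf (Subtype.ext (o.mk_eq_of_toProd ha (Or.inr (by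
            rw [← Prod.swap_swap (o.dart f).toProd, ← h]; rfl))))
        simp [h1, h2, hf]
    rw [Finset.sum_congr rfl fun f _ => key f, Finset.sum_add_distrib, ih]
    simp

/-- The closing property of the fundamental cycle of `e`: the increment of a potential along `e` is
the combination, with coefficients `c_{ef}`, of its increments along the tree. -/
theorem sum_cycleCoeff_mul_diff {R : Type*} [Ring R] (T : SpanningTree G) (y : V → R)
    (e : G.edgeSet) :
    ∑ f : {f // f ∈ T.edges}, (cycleCoeff T o e f : R) * o.diff y f = o.diff y e :=
  o.sum_count_mul_diff y _

end EdgeOrientation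

theorem edgeSet_edgeGraph (F : Finset G.edgeSet) :
    (edgeGraph F).edgeSet = Subtype.val '' (F : Set G.edgeSet) := by
  ext e
  induction e with | h v w =>
  rw [SimpleGraph.mem_edgeSet, edgeGraph_adj]
  simp

theorem card_edgeSet_edgeGraph (F : Finset G.edgeSet) :
    Nat.card (edgeGraph F).edgeSet = F.card := by
  rw [edgeSet_edgeGraph, Nat.card_image_of_injective Subtype.val_injective]
  simp

theorem IsSpanningTree.card_add_one [Fintype V] {F : Finset G.edgeSet} (hF : IsSpanningTree F) :
    F.card + 1 = Fintype.card V := by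
  rw [← card_edgeSet_edgeGraph, ← Nat.card_eq_fintype_card]
  exact (SimpleGraph.isTree_iff_connected_and_card.1 hF).2

theorem isSpanningTree_of_connected [Fintype V] {F : Finset G.edgeSet}
    (hF : (edgeGraph F).Connected) (hc : F.card + 1 = Fintype.card V) : IsSpanningTree F := by
  rw [IsSpanningTree, SimpleGraph.isTree_iff_connected_and_card, card_edgeSet_edgeGraph,
    Nat.card_eq_fintype_card]
  exact ⟨hF, hc⟩

/-- Every function on the edges of a spanning tree is the coboundary of a potential. -/
theorem SpanningTree.exists_potential [Fintype V] (T : SpanningTree G) (o : EdgeOrientation G)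
    {K : Type*} [Field K] (x : {f // f ∈ T.edges} → K) :
    ∃ y : V → K, ∀ f : {f // f ∈ T.edges}, o.diff y f = x f := by
  obtain ⟨r⟩ := T.isSpanningTree.connected.nonempty
  let Φ : (V → K) →ₗ[K] ({f // f ∈ T.edges} → K) × K :=
    { toFun := fun y => (fun f => o.diff y f, y r)
      map_add' := fun y z => by
        ext f
        · simp [EdgeOrientation.diff]; ring
        · simp
      map_smul' := fun c y => by
        ext f
        · simp [EdgeOrientation.diff]; ring
        · simp }
  have hinj : Function.Injective Φ := by
    rw [← LinearMap.ker_eq_bot, LinearMap.ker_eq_bot']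
    intro y hy
    have h1 : ∀ f ∈ T.edges, o.diff y f = 0 := fun f hf =>
      congrFun (congrArg Prod.fst hy) ⟨f, hf⟩
    have h2 : y r = 0 := congrArg Prod.snd hy
    funext v
    rw [o.eq_of_diff_eq_zero T.isSpanningTree.connected.preconnected h1 v r, h2]; rfl
  have hdim : Module.finrank K (V → K) = Module.finrank K (({f // f ∈ T.edges} → K) × K) := by
    simp [← T.isSpanningTree.card_add_one]
  obtain ⟨y, hy⟩ := (LinearMap.injective_iff_surjective_of_finrank_eq_finrank hdim).1 hinj (x, 0)
  exact ⟨y, fun f => congrFun (congrArg Prod.fst hy) f⟩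

/-! ### The determinant of a family of lines -/

/-- The determinant `det [c_{ef} (a_e b_f - b_e a_f)]`. With `a = m`, `b = 1` it is the tree
polynomial evaluated at `m`; in general it is its homogenization, `[a_e : b_e]` being the slope of
the edge `e`. -/
noncomputable def pairDet {R : Type*} [CommRing R] (T : SpanningTree G) (o : EdgeOrientation G)
    (σ : {f // f ∈ T.edges} ≃ {e // e ∉ T.edges}) (a b : G.edgeSet → R) : R :=
  (Matrix.of fun f f' : {f // f ∈ T.edges} => (cycleCoeff T o (σ f) f' : R)
    * (a (σ f) * b f' - b (σ f) * a f')).det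

section pairDet

variable (T : SpanningTree G) (o : EdgeOrientation G)
    (σ : {f // f ∈ T.edges} ≃ {e // e ∉ T.edges})

theorem map_pairDet {R S : Type*} [CommRing R] [CommRing S] (φ : R →+* S) (a b : G.edgeSet → R) :
    φ (pairDet T o σ a b) = pairDet T o σ (φ ∘ a) (φ ∘ b) := by
  rw [pairDet, RingHom.map_det, pairDet]
  congr 1
  ext f f'
  simp

theorem treePolynomial_eq_pairDet (k : Type*) [Field k] :
    treePolynomial k T o σ = pairDet T o σ MvPolynomial.X 1 := by
  rw [treePolynomial, pairDet]
  congr 1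
  ext1 f f'
  simp [treeMatrix]

theorem aeval_treePolynomial {k K : Type*} [Field k] [CommRing K] [Algebra k K]
    (s : G.edgeSet → K) :
    MvPolynomial.aeval s (treePolynomial k T o σ) = pairDet T o σ s 1 := by
  rw [treePolynomial_eq_pairDet, ← AlgHom.coe_toRingHom, map_pairDet]
  congr 1
  · ext e; simp
  · ext e; simp

theorem eval_treePolynomial {k : Type*} [Field k] (s : G.edgeSet → k) :
    MvPolynomial.eval s (treePolynomial k T o σ) = pairDet T o σ s 1 := by
  rw [← aeval_treePolynomial T o σ (k := k)]
  rfl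

theorem pairDet_mul {R : Type*} [CommRing R] (t a b : G.edgeSet → R) :
    pairDet T o σ (t * a) (t * b)
      = (∏ f, t (σ f)) * ((∏ f : {f // f ∈ T.edges}, t f) * pairDet T o σ a b) := by
  rw [pairDet, pairDet, ← Matrix.det_mul_row, ← Matrix.det_mul_column]
  congr 1
  ext f f'
  simp
  ring

/-- A nonconstant planar realization whose edges point in the directions `[b : a]` forces the
determinant to vanish: the ratios of the edge vectors to the directions are in the kernel. -/
theorem pairDet_eq_zero {K : Type*} [Field K] {a b : G.edgeSet → K} {x y : V → K}
    (hab : ∀ e, a e ≠ 0 ∨ b e ≠ 0) (h : ∀ e, b e * o.diff y e = a e * o.diff x e)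
    (hne : ∃ v w, x v ≠ x w ∨ y v ≠ y w) : pairDet T o σ a b = 0 := by
  have hl : ∀ e, ∃ l, o.diff x e = l * b e ∧ o.diff y e = l * a e := by
    intro e
    by_cases hb : b e = 0
    · have ha := (hab e).resolve_right (not_not.2 hb)
      have := h e
      rw [hb, zero_mul, eq_comm, mul_eq_zero] at this
      exact ⟨o.diff y e / a e, by simp [hb, this.resolve_left ha], by field_simp⟩
    · refine ⟨o.diff x e / b e, by field_simp, ?_⟩
      field_simp
      rw [mul_comm, h e, mul_comm]
  choose l hlx hly using hl
  rw [pairDet, ← Matrix.exists_mulVec_eq_zero_iff]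
  refine ⟨fun f => l f, fun hzero => ?_, ?_⟩
  · have hz : ∀ f ∈ T.edges, l f = 0 := fun f hf => congrFun hzero ⟨f, hf⟩
    have hpre := T.isSpanningTree.connected.preconnected
    obtain ⟨v, w, hvw⟩ := hne
    have hx := o.eq_of_diff_eq_zero hpre (y := x) (fun f hf => by rw [hlx, hz f hf, zero_mul]) v w
    have hy := o.eq_of_diff_eq_zero hpre (y := y) (fun f hf => by rw [hly, hz f hf, zero_mul]) v w
    tauto
  · funext f
    have hX := o.sum_cycleCoeff_mul_diff T x (σ f)
    have hY := o.sum_cycleCoeff_mul_diff T y (σ f)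
    calc _ = ∑ f' : {f // f ∈ T.edges}, (a (σ f) * ((cycleCoeff T o (σ f) f' : K) * o.diff x f')
            - b (σ f) * ((cycleCoeff T o (σ f) f' : K) * o.diff y f')) := by
          simp only [Matrix.mulVec, dotProduct, Matrix.of_apply]
          refine Finset.sum_congr rfl fun f' _ => ?_
          rw [hlx, hly]; ring
      _ = 0 := by
          rw [Finset.sum_sub_distrib, ← Finset.mul_sum, ← Finset.mul_sum, hX, hY, h, sub_self]

/-- The tree polynomial vanishes at `s` exactly when there is a realization of `G` in the plane,
not all of whose points have the same abscissa, with edges of slopes `s`. -/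
theorem pairDet_one_eq_zero_iff [Fintype V] {K : Type*} [Field K] {s : G.edgeSet → K} :
    pairDet T o σ s 1 = 0 ↔
      ∃ x y : V → K, (∃ v w, x v ≠ x w) ∧ ∀ e, o.diff y e = s e * o.diff x e := by
  constructor
  · intro h
    rw [pairDet, ← Matrix.exists_mulVec_eq_zero_iff] at h
    obtain ⟨z, hz, hMz⟩ := h
    obtain ⟨x, hx⟩ := T.exists_potential o z
    obtain ⟨y, hy⟩ := T.exists_potential o (fun f => s f * z f)
    refine ⟨x, y, ?_, fun e => ?_⟩
    · by_contra! hcon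
      refine hz (funext fun f => ?_)
      rw [← hx f, EdgeOrientation.diff, hcon _ (o.dart f).fst, sub_self]
      rfl
    · by_cases he : e ∈ T.edges
      · rw [hy ⟨e, he⟩, hx ⟨e, he⟩]
      · obtain ⟨f, hf⟩ := σ.surjective ⟨e, he⟩
        have h1 := congrFun hMz f
        rw [← o.sum_cycleCoeff_mul_diff T y, ← o.sum_cycleCoeff_mul_diff T x, Finset.mul_sum,
          eq_comm, ← sub_eq_zero, ← Finset.sum_sub_distrib]
        rw [← show _ = (0 : K) from h1]
        simp only [Matrix.mulVec, dotProduct, Matrix.of_apply, hf]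
        refine Finset.sum_congr rfl fun f' _ => ?_
        rw [hx, hy, Pi.one_apply, Pi.one_apply]
        ring
  · rintro ⟨x, y, ⟨v, w, hvw⟩, h⟩
    exact pairDet_eq_zero T o σ (fun e => Or.inr one_ne_zero) (fun e => by simpa using h e)
      ⟨v, w, Or.inl hvw⟩

end pairDet

/-! ### Expansion over coupled spanning trees -/

section expansion

variable {V : Type*} {G : SimpleGraph V} (T : SpanningTree G)

/-- Each term of the Leibniz expansion of the tree polynomial is a product of differences of
variables that are all distinct, so that it involves only squarefree monomials. -/
theorem prod_X_sub_X_mem_span {k : Type*} [Field k] (τ : {f // f ∈ T.edges} ≃ {e // e ∉ T.edges}) :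
    ∏ f, (MvPolynomial.X (τ f).1 - MvPolynomial.X f.1 : MvPolynomial G.edgeSet k) ∈
      Submodule.span k (Set.range
        fun S : {S : Finset G.edgeSet // S.card = T.edges.card} => edgeMonomial k S.1) := by
  simp_rw [sub_eq_add_neg]
  rw [Finset.prod_add]
  refine Submodule.sum_mem _ fun A _ => ?_
  rw [Finset.prod_neg, mul_left_comm]
  have hinj1 : Function.Injective fun f => (τ f).1 := Subtype.val_injective.comp τ.injective
  have hdisj : Disjoint (A.image fun f => (τ f).1) ((Finset.univ \ A).image Subtype.val) := by
    rw [Finset.disjoint_left]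
    intro e he he'
    obtain ⟨f, -, rfl⟩ := Finset.mem_image.1 he
    obtain ⟨f', -, h⟩ := Finset.mem_image.1 he'
    exact (τ f).2 (h ▸ f'.2)
  have hcard : ((A.image fun f => (τ f).1) ∪ (Finset.univ \ A).image Subtype.val).card
      = T.edges.card := by
    rw [Finset.card_union_of_disjoint hdisj, Finset.card_image_of_injective _ hinj1,
      Finset.card_image_of_injective _ Subtype.val_injective, add_comm,
      Finset.card_sdiff_add_card_eq_card (Finset.subset_univ A)]
    simp
  have hmon : (∏ f ∈ A, MvPolynomial.X (τ f).1) * ∏ f ∈ Finset.univ \ A, MvPolynomial.X f.1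
      = edgeMonomial k ((A.image fun f => (τ f).1) ∪ (Finset.univ \ A).image Subtype.val) := by
    rw [edgeMonomial, Finset.prod_union hdisj, Finset.prod_image fun _ _ _ _ h => hinj1 h,
      Finset.prod_image fun _ _ _ _ h => Subtype.val_injective h]
  rw [hmon]
  have := Submodule.smul_mem _ ((-1 : k) ^ (Finset.univ \ A).card)
    (Submodule.subset_span (R := k) (Set.mem_range_self (f := fun S :
      {S : Finset G.edgeSet // S.card = T.edges.card} => edgeMonomial k S.1) ⟨_, hcard⟩))
  rw [Algebra.smul_def] at this
  simpa using this

theorem eval_indicator_edgeMonomial {k : Type*} [Field k] {S S' : Finset G.edgeSet}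
    (h : S'.card = S.card) :
    MvPolynomial.eval (fun e => if e ∈ S then 1 else 0) (edgeMonomial k S')
      = if S' = S then 1 else 0 := by
  rw [edgeMonomial, map_prod]
  simp only [MvPolynomial.eval_X]
  rw [Finset.prod_boole]
  congr 1
  rw [eq_iff_iff]
  exact ⟨fun H => Finset.eq_of_subset_of_card_le H h.ge, fun H => H ▸ fun _ h => h⟩

variable (o : EdgeOrientation G) (σ : {f // f ∈ T.edges} ≃ {e // e ∉ T.edges})

theorem treePolynomial_mem_span (k : Type*) [Field k] :
    treePolynomial k T o σ ∈ Submodule.span k (Set.range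
        fun S : {S : Finset G.edgeSet // S.card = T.edges.card} => edgeMonomial k S.1) := by
  rw [treePolynomial, Matrix.det_apply]
  refine Submodule.sum_mem _ fun π _ => ?_
  rw [Units.smul_def, ← Int.cast_smul_eq_zsmul k]
  refine Submodule.smul_mem _ _ ?_
  simp only [Matrix.submatrix_apply, treeMatrix, Matrix.of_apply, id, Finset.prod_mul_distrib]
  rw [← Int.cast_prod, ← zsmul_eq_mul, ← Int.cast_smul_eq_zsmul k]
  exact Submodule.smul_mem _ _ (prod_X_sub_X_mem_span T (π.trans σ))

/-- The value of the tree polynomial, with integer coefficients, at the indicator function of `S`.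
The monomials of the tree polynomial being squarefree of degree `n - 1`, this is the coefficient
of `m_S` when `S` has `n - 1` elements. -/
noncomputable def treeSign (S : Finset G.edgeSet) : ℤ :=
  pairDet T o σ (fun e => if e ∈ S then 1 else 0) 1

theorem cast_treeSign {R : Type*} [CommRing R] (S : Finset G.edgeSet) :
    (treeSign T o σ S : R) = pairDet T o σ (fun e => if e ∈ S then 1 else 0) 1 := by
  rw [treeSign, ← eq_intCast (Int.castRingHom R), map_pairDet]
  congr 1
  · ext e; simp
  · ext e; simp

theorem eval_indicator_treePolynomial {k : Type*} [Field k] (S : Finset G.edgeSet) :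
    MvPolynomial.eval (fun e => if e ∈ S then 1 else 0) (treePolynomial k T o σ)
      = (treeSign T o σ S : k) := by
  rw [eval_treePolynomial, cast_treeSign]

variable [Fintype V]

theorem card_compl_of_equiv {T : SpanningTree G} (σ : {f // f ∈ T.edges} ≃ {e // e ∉ T.edges})
    {S : Finset G.edgeSet} (hS : S.card = T.edges.card) : Sᶜ.card = T.edges.card := by
  have h1 : T.edges.card = T.edgesᶜ.card := by
    simpa [← Finset.mem_compl] using Fintype.card_congr σ
  rw [Finset.card_compl, hS, ← Finset.card_compl, h1]

/-- For the slopes `1` on `S` and `0` off `S`, a realization `(x, y)` has `y` constant along `E ∖ S`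
and `y - x` constant along `S`. If `S` is coupled then it is constant, over every field; so no prime
divides the coefficient. -/
theorem treeSign_coupled {S : Finset G.edgeSet} (hS : IsCoupled S) :
    treeSign T o σ S = 1 ∨ treeSign T o σ S = -1 := by
  rw [← Int.isUnit_iff, Int.isUnit_iff_natAbs_eq]
  by_contra hne
  obtain ⟨p, hp, hdvd⟩ := Nat.exists_prime_and_dvd hne
  have := Fact.mk hp
  have h0 : (treeSign T o σ S : ZMod p) = 0 :=
    (ZMod.intCast_zmod_eq_zero_iff_dvd _ _).2 (Int.natCast_dvd.2 hdvd)
  rw [cast_treeSign, pairDet_one_eq_zero_iff] at h0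
  obtain ⟨x, y, ⟨v, w, hvw⟩, h⟩ := h0
  have hy := o.eq_of_diff_eq_zero hS.2.connected.preconnected (y := y)
    (fun f hf => by rw [h, if_neg (Finset.mem_compl.1 hf), zero_mul]) v w
  have hz := o.eq_of_diff_eq_zero hS.1.connected.preconnected (y := fun v => y v - x v)
    (fun f hf => by
      have := h f
      rw [if_pos hf, one_mul] at this
      simp only [EdgeOrientation.diff] at this ⊢
      linear_combination this) v w
  simp only [hy] at hz
  exact hvw (sub_right_injective hz)

theorem exists_component_indicator {K : Type*} [Field K] {F : Finset G.edgeSet}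
    (hF : ¬ (edgeGraph F).Preconnected) :
    ∃ x : V → K, (∃ v w, x v ≠ x w) ∧ ∀ f ∈ F, o.diff x f = 0 := by
  simp only [SimpleGraph.Preconnected, not_forall] at hF
  obtain ⟨v, w, hvw⟩ := hF
  refine ⟨fun u => if (edgeGraph F).Reachable v u then 1 else 0, ⟨v, w, by simp [hvw]⟩,
    fun f hf => ?_⟩
  have hadj : (edgeGraph F).Adj (o.dart f).fst (o.dart f).snd :=
    edgeGraph_adj.2 ⟨(o.dart f).adj, by convert hf; exact Subtype.ext (o.mk_fst_snd f)⟩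
  have : (edgeGraph F).Reachable v (o.dart f).snd ↔ (edgeGraph F).Reachable v (o.dart f).fst :=
    ⟨fun h => h.trans hadj.symm.reachable, fun h => h.trans hadj.reachable⟩
  simp [EdgeOrientation.diff, this]

/-- If `S` is not coupled, one of the graphs `(V, S)` and `(V, E ∖ S)` is disconnected, and a function
constant on its components gives a realization with slopes `1` on `S` and `0` off `S`. -/
theorem treeSign_not_coupled {S : Finset G.edgeSet} (hS : ¬ IsCoupled S)
    (hc : S.card = T.edges.card) : treeSign T o σ S = 0 := by
  have hT := T.isSpanningTree.card_add_one
  have := T.isSpanningTree.connected.nonempty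
  apply Int.cast_injective (α := ℚ)
  rw [cast_treeSign, Int.cast_zero, pairDet_one_eq_zero_iff]
  by_cases h1 : (edgeGraph S).Preconnected
  · have h2 : ¬ (edgeGraph Sᶜ).Preconnected := fun h2 => hS
      ⟨isSpanningTree_of_connected ⟨h1⟩ (by rw [hc, hT]),
        isSpanningTree_of_connected ⟨h2⟩ (by rw [card_compl_of_equiv σ hc, hT])⟩
    obtain ⟨x, hx, hx0⟩ := exists_component_indicator o (K := ℚ) h2
    refine ⟨x, x, hx, fun e => ?_⟩
    split_ifs with he
    · simp
    · simp [hx0 e (Finset.mem_compl.2 he)]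
  · obtain ⟨x, hx, hx0⟩ := exists_component_indicator o (K := ℚ) h1
    refine ⟨x, 0, hx, fun e => ?_⟩
    split_ifs with he
    · rw [hx0 e he]; simp [EdgeOrientation.diff]
    · simp [EdgeOrientation.diff]

/-- Replacing `S` by its complement negates every difference `m_e - m_f`. -/
theorem treeSign_compl (S : Finset G.edgeSet) :
    treeSign T o σ Sᶜ = (-1) ^ (Fintype.card V - 1) * treeSign T o σ S := by
  have hT : Fintype.card V - 1 = Fintype.card {f // f ∈ T.edges} := by
    rw [← T.isSpanningTree.card_add_one]; simp
  rw [treeSign, treeSign, pairDet, pairDet, hT, ← Matrix.det_neg]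
  congr 1
  ext f f'
  simp only [Matrix.of_apply, Matrix.neg_apply, Pi.one_apply, Finset.mem_compl]
  split_ifs <;> simp_all

/-- The expansion of the tree polynomial over the coupled spanning trees. -/
theorem treePolynomial_eq_sum (k : Type*) [Field k] :
    treePolynomial k T o σ = ∑ S ∈ coupledTrees G,
      (treeSign T o σ S : MvPolynomial G.edgeSet k) * edgeMonomial k S := by
  obtain ⟨c, hc⟩ := (Submodule.mem_span_range_iff_exists_fun k).1 (treePolynomial_mem_span T o σ k)
  have hcoef : ∀ S, c S = (treeSign T o σ S.1 : k) := by
    intro S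
    rw [← eval_indicator_treePolynomial, ← hc, map_sum, Finset.sum_eq_single S]
    · rw [MvPolynomial.smul_eval, eval_indicator_edgeMonomial rfl, if_pos rfl, mul_one]
    · intro S' _ hne
      rw [MvPolynomial.smul_eval, eval_indicator_edgeMonomial (S'.2.trans S.2.symm),
        if_neg fun h => hne (Subtype.ext h), mul_zero]
    · simp
  rw [← hc, coupledTrees]
  have hsub : (Finset.univ.filter IsCoupled : Finset (Finset G.edgeSet)) ⊆
      Finset.univ.filter fun S => S.card = T.edges.card := by
    intro S hS
    simp only [Finset.mem_filter, Finset.mem_univ, true_and] at hS ⊢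
    have := hS.1.card_add_one
    have := T.isSpanningTree.card_add_one
    omega
  rw [Finset.sum_subset hsub, Finset.sum_subtype
    (p := fun S : Finset G.edgeSet => S.card = T.edges.card) _ (fun S => by simp)]
  · refine Finset.sum_congr rfl fun S _ => ?_
    rw [hcoef, Algebra.smul_def, MvPolynomial.algebraMap_eq, map_intCast]
  · intro S hS hS'
    simp only [Finset.mem_filter, Finset.mem_univ, true_and] at hS hS'
    rw [treeSign_not_coupled T o σ hS' hS, Int.cast_zero, zero_mul]

theorem treePolynomial_ne_zero_iff (k : Type*) [Field k] :
    treePolynomial k T o σ ≠ 0 ↔ IsRigidityPseudocircuit G := by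
  constructor
  · intro h
    by_contra hcon
    refine h ?_
    rw [treePolynomial_eq_sum]
    refine Finset.sum_eq_zero fun S hS => absurd ⟨S, ?_⟩ hcon
    simpa [coupledTrees] using hS
  · rintro ⟨S, hS⟩ h0
    have h := eval_indicator_treePolynomial T o σ (k := k) S
    rw [h0, map_zero] at h
    rcases treeSign_coupled T o σ hS with h1 | h1 <;> simp [h1] at h

theorem isHomogeneous_treePolynomial (k : Type*) [Field k] :
    (treePolynomial k T o σ).IsHomogeneous T.edges.card := by
  rw [treePolynomial_eq_sum]
  refine MvPolynomial.IsHomogeneous.sum _ _ _ fun S hS => ?_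
  have hS' : IsCoupled S := by simpa [coupledTrees] using hS
  have hc : S.card = T.edges.card := by
    have := hS'.1.card_add_one
    have := T.isSpanningTree.card_add_one
    omega
  rw [← zsmul_eq_mul, ← Int.cast_smul_eq_zsmul k, MvPolynomial.smul_eq_C_mul, edgeMonomial, ← hc]
  convert (MvPolynomial.isHomogeneous_C _ _).mul (MvPolynomial.IsHomogeneous.prod S _
    (fun _ => 1) fun e _ => MvPolynomial.isHomogeneous_X k e) using 1
  simp

theorem degreeOf_treePolynomial_le (k : Type*) [Field k] (e : G.edgeSet) :
    (treePolynomial k T o σ).degreeOf e ≤ 1 := by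
  rw [treePolynomial_eq_sum]
  refine (MvPolynomial.degreeOf_sum_le _ _ _).trans (Finset.sup_le fun S _ => ?_)
  rw [← zsmul_eq_mul, ← Int.cast_smul_eq_zsmul k, MvPolynomial.smul_eq_C_mul]
  refine (MvPolynomial.degreeOf_C_mul_le _ _ _).trans ?_
  refine (MvPolynomial.degreeOf_prod_le _ _ _).trans ?_
  simp only [MvPolynomial.degreeOf_X]
  rw [Finset.sum_ite_eq]
  split_ifs <;> simp

end expansion

/-! ### Multiaffine polynomials -/

section multiaffine

variable {ι k : Type*} [Field k]

theorem isUnit_of_degreeOf_eq_zero {p : MvPolynomial ι k} (hp : p ≠ 0)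
    (h : ∀ i, p.degreeOf i = 0) : IsUnit p := by
  have hv : p.vars = ∅ := Finset.eq_empty_of_forall_notMem fun i hi =>
    MvPolynomial.mem_vars_iff_degreeOf_ne_zero.1 hi (h i)
  rw [MvPolynomial.vars_eq_empty_iff_eq_C] at hv
  rw [hv]
  exact (Ne.isUnit fun hc => hp (by rw [hv, hc, map_zero])).map MvPolynomial.C

/-- A nonzero polynomial of degree at most one in each variable is squarefree. -/
theorem squarefree_of_degreeOf_le_one {p : MvPolynomial ι k} (hp : p ≠ 0)
    (h : ∀ i, p.degreeOf i ≤ 1) : Squarefree p := by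
  rintro q ⟨r, rfl⟩
  have hq : q ≠ 0 := fun hq => hp (by simp [hq])
  have hr : r ≠ 0 := fun hr => hp (by simp [hr])
  refine isUnit_of_degreeOf_eq_zero hq fun i => ?_
  have := h i
  rw [MvPolynomial.degreeOf_mul_eq (mul_ne_zero hq hq) hr, MvPolynomial.degreeOf_mul_eq hq hq]
    at this
  omega

/-- The Nullstellensatz for the hypersurface of a squarefree polynomial. -/
theorem dvd_of_forall_eval_eq_zero [IsAlgClosed k] [Finite ι] {p q : MvPolynomial ι k}
    (hp : Squarefree p) (h : ∀ s, MvPolynomial.eval s p = 0 → MvPolynomial.eval s q = 0) :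
    p ∣ q := by
  have hq : q ∈ MvPolynomial.vanishingIdeal k (MvPolynomial.zeroLocus k (Ideal.span {p})) := by
    intro s hs
    exact h s (hs p (Ideal.mem_span_singleton_self p))
  rw [MvPolynomial.vanishingIdeal_zeroLocus_eq_radical] at hq
  obtain ⟨n, hn⟩ := hq
  exact hp.isRadical n q (Ideal.mem_span_singleton.1 hn)

end multiaffine

/-! ### Pseudocircuit subgraphs -/

section subgraph

variable {V : Type*} [Fintype V] {G : SimpleGraph V}

theorem card_edgeSet_of_equiv {T : SpanningTree G}
    (σ : {f // f ∈ T.edges} ≃ {e // e ∉ T.edges}) :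
    Fintype.card G.edgeSet + 2 = 2 * Fintype.card V := by
  have h := Finset.card_add_card_compl T.edges
  rw [card_compl_of_equiv σ rfl] at h
  have := T.isSpanningTree.card_add_one
  omega

/-- A realization of a subgraph with two edges less than twice its number of vertices extends, or
else the whole graph has a realization collapsing the subgraph to a point: the conditions on an
extension form a square linear system. -/
theorem pairDet_eq_zero_of_subgraph (T : SpanningTree G) (o : EdgeOrientation G)
    (σ : {f // f ∈ T.edges} ≃ {e // e ∉ T.edges}) (G' : G.Subgraph) (T' : SpanningTree G'.coe)
    (o' : EdgeOrientation G'.coe) (σ' : {f // f ∈ T'.edges} ≃ {e // e ∉ T'.edges})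
    {K : Type*} [Field K] {s : G.edgeSet → K}
    (h : pairDet T' o' σ' (s ∘ G'.hom.mapEdgeSet) 1 = 0) : pairDet T o σ s 1 = 0 := by
  have hinj := SimpleGraph.Hom.mapEdgeSet.injective G'.hom G'.hom_injective
  obtain ⟨u⟩ := T'.isSpanningTree.connected.nonempty
  rw [pairDet_one_eq_zero_iff] at h ⊢
  obtain ⟨x', y', ⟨v', w', hne⟩, h'⟩ := h
  rw [o'.diff_ext_iff] at h'
  set D : Finset G.edgeSet := (Finset.univ.image G'.hom.mapEdgeSet)ᶜ with hD
  have hmemD : ∀ e, e ∉ D ↔ ∃ v w, ∃ h : G'.coe.Adj v w, G'.hom.mapEdgeSet ⟨s(v, w), h⟩ = e := by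
    intro e
    simp only [hD, Finset.mem_compl, not_not, Finset.mem_image, Finset.mem_univ, true_and]
    constructor
    · rintro ⟨⟨e', he'⟩, rfl⟩
      induction e' with | h v w => exact ⟨v, w, he', rfl⟩
    · rintro ⟨v, w, h, rfl⟩
      exact ⟨_, rfl⟩
  let Φ : (V → K) × (V → K) →ₗ[K] (D → K) × ((G'.verts → K) × (G'.verts → K)) :=
    { toFun := fun p => (fun e => o.diff p.2 e - s e * o.diff p.1 e,
        (fun v => p.1 v, fun v => p.2 v))
      map_add' := fun p q => by
        ext e
        · simp [EdgeOrientation.diff]; ring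
        · simp
        · simp
      map_smul' := fun c p => by
        ext e
        · simp [EdgeOrientation.diff]; ring
        · simp
        · simp }
  have hdim : Module.finrank K ((V → K) × (V → K))
      = Module.finrank K ((D → K) × ((G'.verts → K) × (G'.verts → K))) := by
    have h1 := card_edgeSet_of_equiv σ
    have h2 := card_edgeSet_of_equiv σ'
    have h3 : D.card + Fintype.card G'.coe.edgeSet = Fintype.card G.edgeSet := by
      rw [← Finset.card_univ, ← Finset.card_image_of_injective _ hinj, add_comm, hD,
        Finset.card_add_card_compl]
    simp only [Module.finrank_prod, Module.finrank_fintype_fun_eq_card, Fintype.card_coe]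
    simp only [← Nat.card_eq_fintype_card] at h1 h2 h3 ⊢
    omega
  -- `Φ` is square: both graphs have two edges less than twice their numbers of vertices.
  by_cases hΦ : Function.Injective Φ
  · obtain ⟨⟨x, y⟩, hxy⟩ := (LinearMap.injective_iff_surjective_of_finrank_eq_finrank hdim).1 hΦ
      (0, (x', y'))
    have hx : ∀ v : G'.verts, x v = x' v := fun v => congrFun (congrArg (fun z => z.2.1) hxy) v
    have hy : ∀ v : G'.verts, y v = y' v := fun v => congrFun (congrArg (fun z => z.2.2) hxy) v
    refine ⟨x, y, ⟨v', w', by rwa [hx, hx]⟩, fun e => ?_⟩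
    by_cases he : e ∈ D
    · exact sub_eq_zero.1 (congrFun (congrArg Prod.fst hxy) ⟨e, he⟩)
    · obtain ⟨v, w, hvw, rfl⟩ := (hmemD e).1 he
      refine (o.diff_eq_mul_iff (G'.hom.map_adj hvw)).2 ?_
      have := h' v w hvw
      rwa [← hx, ← hx, ← hy, ← hy] at this
  · rw [← LinearMap.ker_eq_bot, LinearMap.ker_eq_bot'] at hΦ
    push Not at hΦ
    obtain ⟨⟨x, y⟩, hxy, hne0⟩ := hΦ
    have hx : ∀ v : G'.verts, x v = 0 := fun v => congrFun (congrArg (fun z => z.2.1) hxy) v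
    have hy : ∀ v : G'.verts, y v = 0 := fun v => congrFun (congrArg (fun z => z.2.2) hxy) v
    have hpic : ∀ e, o.diff y e = s e * o.diff x e := by
      intro e
      by_cases he : e ∈ D
      · exact sub_eq_zero.1 (congrFun (congrArg Prod.fst hxy) ⟨e, he⟩)
      · obtain ⟨v, w, hvw, rfl⟩ := (hmemD e).1 he
        refine (o.diff_eq_mul_iff (G'.hom.map_adj hvw)).2 ?_
        change y w - y v = _ * (x w - x v)
        rw [hx, hx, hy, hy]; simp
    refine ⟨x, y, ?_, hpic⟩
    by_contra! hcon
    have hx0 : x = 0 := funext fun v => (hcon v u).trans (hx u)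
    refine hne0 (Prod.ext hx0 (funext fun v => ?_))
    have hpre := T.isSpanningTree.connected.preconnected
    refine (o.eq_of_diff_eq_zero hpre (fun f _ => ?_) v u).trans (hy u)
    rw [hpic, hx0]
    simp [EdgeOrientation.diff]

/-- The tree polynomial of a pseudocircuit is squarefree, and its zeros are zeros of the tree
polynomial of every graph with `2n - 2` edges containing the pseudocircuit. -/
theorem rename_treePolynomial_dvd {k : Type*} [Field k] [IsAlgClosed k] (T : SpanningTree G)
    (o : EdgeOrientation G) (σ : {f // f ∈ T.edges} ≃ {e // e ∉ T.edges}) (G' : G.Subgraph)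
    (hG' : IsRigidityPseudocircuit G'.coe) (T' : SpanningTree G'.coe)
    (o' : EdgeOrientation G'.coe) (σ' : {f // f ∈ T'.edges} ≃ {e // e ∉ T'.edges}) :
    MvPolynomial.rename G'.hom.mapEdgeSet (treePolynomial k T' o' σ')
      ∣ treePolynomial k T o σ := by
  have hinj := SimpleGraph.Hom.mapEdgeSet.injective G'.hom G'.hom_injective
  have h0 := (treePolynomial_ne_zero_iff T' o' σ' k).2 hG'
  refine dvd_of_forall_eval_eq_zero (squarefree_of_degreeOf_le_one ?_ fun e => ?_) fun s hs => ?_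
  · rwa [Ne, map_eq_zero_iff _ (MvPolynomial.rename_injective _ hinj)]
  · by_cases he : e ∈ Set.range G'.hom.mapEdgeSet
    · obtain ⟨e', rfl⟩ := he
      rw [MvPolynomial.degreeOf_rename_of_injective hinj]
      exact degreeOf_treePolynomial_le T' o' σ' k e'
    · have : e ∉ (MvPolynomial.rename G'.hom.mapEdgeSet (treePolynomial k T' o' σ')).vars :=
        fun h => he (by
          obtain ⟨e', -, h'⟩ := MvPolynomial.mem_vars_rename _ _ h
          exact ⟨e', h'⟩)
      rw [MvPolynomial.mem_vars_iff_degreeOf_ne_zero, not_not] at this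
      omega
  · rw [MvPolynomial.eval_rename, eval_treePolynomial] at hs
    rw [eval_treePolynomial]
    exact pairDet_eq_zero_of_subgraph T o σ G' T' o' σ' hs

end subgraph

/-! ### Vanishing on the picture variety -/

section pictures

variable {V : Type*} {G : SimpleGraph V} (T : SpanningTree G) (o : EdgeOrientation G)
    (σ : {f // f ∈ T.edges} ≃ {e // e ∉ T.edges})

theorem isWeightedHomogeneous_pairDet {R ι M : Type*} [CommRing R] [AddCommMonoid M] {w : ι → M}
    {a b : G.edgeSet → MvPolynomial ι R} {d : G.edgeSet → M}
    (ha : ∀ e, (a e).IsWeightedHomogeneous w (d e))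
    (hb : ∀ e, (b e).IsWeightedHomogeneous w (d e)) :
    (pairDet T o σ a b).IsWeightedHomogeneous w
      (∑ f, d (σ f) + ∑ f : {f // f ∈ T.edges}, d f) := by
  rw [pairDet, Matrix.det_apply, ← MvPolynomial.mem_weightedHomogeneousSubmodule]
  refine Submodule.sum_mem _ fun π _ => ?_
  rw [Units.smul_def, ← Int.cast_smul_eq_zsmul R]
  refine Submodule.smul_mem _ _ ?_
  rw [MvPolynomial.mem_weightedHomogeneousSubmodule, ← Equiv.sum_comp π fun f => d (σ f),
    ← Finset.sum_add_distrib]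
  refine MvPolynomial.IsWeightedHomogeneous.prod _ _ _ fun f _ => ?_
  rw [Matrix.of_apply, ← zsmul_eq_mul, ← Int.cast_smul_eq_zsmul R,
    ← MvPolynomial.mem_weightedHomogeneousSubmodule]
  refine Submodule.smul_mem _ _ (Submodule.sub_mem _ ?_ ?_)
  · exact (ha _).mul (hb _)
  · exact (hb _).mul (ha _)

variable {k : Type*} [Field k]

open MvPolynomial (X C) in
/-- The homogenized tree polynomial vanishes on generic pictures. A projective change of
coordinates with indeterminate coefficients moves all the points of the picture to the affine
plane, where the statement is linear algebra; specializing the indeterminates to zero gives the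
original picture back. -/
theorem pairDet_eq_zero_of_generic [Fintype V] (hn : 2 ≤ Fintype.card V) {Q : Gr k G}
    (hQ : Q ∈ genericPictures k G) :
    pairDet T o σ (fun e => -(Q (Sum.inr e)).rep 1) (fun e => (Q (Sum.inr e)).rep 2) = 0 := by
  obtain ⟨hinc, hinj⟩ := hQ
  have : Nontrivial V := Fintype.one_lt_card_iff_nontrivial.1 hn
  obtain ⟨v₀, w₀, hvw⟩ := exists_pair_ne V
  set p : V → Fin 3 → k := fun v => (Q (Sum.inl v)).rep with hp
  set l : G.edgeSet → Fin 3 → k := fun e => (Q (Sum.inr e)).rep with hl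
  have hdot : ∀ (e : G.edgeSet), ∀ v ∈ (e : Sym2 V),
      p v 0 * l e 0 + p v 1 * l e 1 + p v 2 * l e 2 = 0 := by
    intro e v hv
    have := hinc e v hv
    rw [← (Q (Sum.inl v)).mk_rep, ← (Q (Sum.inr e)).mk_rep, Projectivization.orthogonal_mk] at this
    simpa [dotProduct, Fin.sum_univ_three] using this
  -- The first coordinate `a₀ + t₀ a₁ + t₁ a₂` of a transformed point, the other two being unchanged;
  -- `l₁` and `l₂` are the matching coordinates of the transformed lines.
  let A : V → MvPolynomial (Fin 2) k := fun v => C (p v 0) + X 0 * C (p v 1) + X 1 * C (p v 2)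
  have hA : ∀ v, A v ≠ 0 := by
    intro v hv
    refine (Q (Sum.inl v)).rep_nonzero ?_
    have h0 := congrArg (MvPolynomial.eval (![0, 0] : Fin 2 → k)) hv
    have h1 := congrArg (MvPolynomial.eval (![1, 0] : Fin 2 → k)) hv
    have h2 := congrArg (MvPolynomial.eval (![0, 1] : Fin 2 → k)) hv
    simp only [A, map_add, map_mul, MvPolynomial.eval_C, MvPolynomial.eval_X, map_zero,
      Matrix.cons_val_zero, Matrix.cons_val_one, zero_mul, one_mul, add_zero] at h0 h1 h2
    rw [h0, zero_add] at h1 h2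
    funext i
    fin_cases i
    · exact h0
    · exact h1
    · exact h2
  let l₁ : G.edgeSet → MvPolynomial (Fin 2) k := fun e => C (l e 1) - X 0 * C (l e 0)
  let l₂ : G.edgeSet → MvPolynomial (Fin 2) k := fun e => C (l e 2) - X 1 * C (l e 0)
  have hdot' : ∀ (e : G.edgeSet), ∀ v ∈ (e : Sym2 V),
      A v * C (l e 0) + C (p v 1) * l₁ e + C (p v 2) * l₂ e = 0 := by
    intro e v hv
    have h := congrArg (C (σ := Fin 2)) (hdot e v hv)
    simp only [map_add, map_mul, map_zero] at h
    simp only [A, l₁, l₂]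
    linear_combination h
  let ι : MvPolynomial (Fin 2) k →+* FractionRing (MvPolynomial (Fin 2) k) := algebraMap _ _
  have hι : Function.Injective ι := IsFractionRing.injective _ (FractionRing (MvPolynomial (Fin 2) k))
  have hιA : ∀ v, ι (A v) ≠ 0 := fun v h => hA v (hι (by rw [h, map_zero]))
  have key : pairDet T o σ (fun e => -l₁ e) l₂ = 0 := by
    apply hι
    rw [map_pairDet, map_zero]
    refine pairDet_eq_zero T o σ (x := fun v => ι (C (p v 1)) / ι (A v))
      (y := fun v => ι (C (p v 2)) / ι (A v)) (fun e => ?_) (fun e => ?_) ⟨v₀, w₀, ?_⟩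
    · by_contra! hcon
      obtain ⟨h1, h2⟩ := hcon
      have h1' : l₁ e = 0 := hι (by simpa using h1)
      have h2' : l₂ e = 0 := hι (by simpa using h2)
      refine (Q (Sum.inr e)).rep_nonzero ?_
      have h10 := congrArg (MvPolynomial.eval (![0, 0] : Fin 2 → k)) h1'
      have h11 := congrArg (MvPolynomial.eval (![1, 0] : Fin 2 → k)) h1'
      have h20 := congrArg (MvPolynomial.eval (![0, 0] : Fin 2 → k)) h2'
      simp only [l₁, l₂, map_sub, map_mul, MvPolynomial.eval_C, MvPolynomial.eval_X,
        map_zero, Matrix.cons_val_zero, Matrix.cons_val_one, zero_mul, one_mul, sub_zero]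
        at h10 h11 h20
      rw [h10, zero_sub, neg_eq_zero] at h11
      funext i
      fin_cases i
      · exact h11
      · exact h10
      · exact h20
    · have hmem := o.mk_fst_snd e
      have h1 := congrArg ι (hdot' e (o.dart e).fst (hmem ▸ Sym2.mem_mk_left _ _))
      have h2 := congrArg ι (hdot' e (o.dart e).snd (hmem ▸ Sym2.mem_mk_right _ _))
      have ha1 := hιA (o.dart e).fst
      have ha2 := hιA (o.dart e).snd
      simp only [map_add, map_mul, map_zero] at h1 h2
      simp only [EdgeOrientation.diff, Function.comp_apply, map_neg]
      field_simp
      linear_combination ι (A (o.dart e).fst) * h2 - ι (A (o.dart e).snd) * h1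
    · by_contra! hcon
      obtain ⟨h1, h2⟩ := hcon
      rw [div_eq_div_iff (hιA _) (hιA _), ← map_mul, ← map_mul] at h1 h2
      have h1 := hι h1
      have h2 := hι h2
      have h0 : C (p v₀ 0) * A w₀ = C (p w₀ 0) * A v₀ := by
        have e1 : A v₀ = C (p v₀ 0) + X 0 * C (p v₀ 1) + X 1 * C (p v₀ 2) := rfl
        have e2 : A w₀ = C (p w₀ 0) + X 0 * C (p w₀ 1) + X 1 * C (p w₀ 2) := rfl
        linear_combination A w₀ * (-e1) + A v₀ * e2 - X 0 * h1 - X 1 * h2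
      have hall : ∀ i, C (p v₀ i) * A w₀ = C (p w₀ i) * A v₀ := by
        intro i
        fin_cases i
        · exact h0
        · exact h1
        · exact h2
      have hprop : ∀ i j, p v₀ i * p w₀ j = p v₀ j * p w₀ i := by
        intro i j
        apply MvPolynomial.C_injective (Fin 2) k
        apply mul_right_cancel₀ (hA w₀)
        change C _ * A w₀ = C _ * A w₀
        rw [map_mul, map_mul]
        linear_combination C (p w₀ j) * hall i - C (p w₀ i) * hall j
      refine hvw (hinj ?_)
      change Q (Sum.inl v₀) = Q (Sum.inl w₀)
      rw [← (Q (Sum.inl v₀)).mk_rep, ← (Q (Sum.inl w₀)).mk_rep,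
        Projectivization.mk_eq_mk_iff_crossProduct_eq_zero, cross_apply]
      funext i
      fin_cases i
      · exact sub_eq_zero.2 (hprop 1 2)
      · exact sub_eq_zero.2 (hprop 2 0)
      · exact sub_eq_zero.2 (hprop 0 1)
  have := congrArg (MvPolynomial.eval (0 : Fin 2 → k)) key
  rw [map_pairDet, map_zero] at this
  convert this using 2
  · funext e
    simp [l₁, hl]
  · funext e
    simp [l₂, hl]

/-- The homogenized determinant is multihomogeneous, so it may be used to test membership in the
picture variety; where all lines are nonvertical it is a nonzero multiple of the tree polynomial. -/
theorem eval_eq_zero_of_mem_affineSlopeVariety [Fintype V] (hn : 2 ≤ Fintype.card V)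
    {m : G.edgeSet → k} (hm : m ∈ affineSlopeVariety k G) :
    MvPolynomial.eval m (treePolynomial k T o σ) = 0 := by
  obtain ⟨P, hP, hvert, rfl⟩ := hm
  have hF := hP _ (pairDet T o σ (fun e => -MvPolynomial.X (Sum.inr e, 1))
    (fun e => MvPolynomial.X (Sum.inr e, 2)))
    (isWeightedHomogeneous_pairDet T o σ (d := fun e => Finsupp.single (Sum.inr e) 1)
      (fun e => by
        rw [← MvPolynomial.mem_weightedHomogeneousSubmodule]
        exact Submodule.neg_mem _ (MvPolynomial.isWeightedHomogeneous_X k _ (Sum.inr e, 1)))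
      (fun e => MvPolynomial.isWeightedHomogeneous_X k _ (Sum.inr e, 2)))
  have hev : ∀ Q : Gr k G, VanishesAt (pairDet T o σ (fun e => -MvPolynomial.X (Sum.inr e, 1))
      (fun e => MvPolynomial.X (Sum.inr e, 2))) Q ↔
      pairDet T o σ (fun e => -(Q (Sum.inr e)).rep 1) (fun e => (Q (Sum.inr e)).rep 2) = 0 := by
    intro Q
    rw [VanishesAt, map_pairDet]
    simp [Function.comp_def]
  have h0 := (hev P).1 (hF fun Q hQ => (hev Q).2 (pairDet_eq_zero_of_generic T o σ hn hQ))
  have hfac := pairDet_mul T o σ (fun e => (P (Sum.inr e)).rep 2) (slopes P) 1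
  have h1 : (fun e => (P (Sum.inr e)).rep 2) * slopes P = fun e => -(P (Sum.inr e)).rep 1 := by
    funext e
    exact mul_div_cancel₀ _ (hvert e)
  rw [h1, mul_one, h0, eq_comm, mul_eq_zero, mul_eq_zero] at hfac
  rw [eval_treePolynomial]
  refine (hfac.resolve_left ?_).resolve_left ?_ <;>
  exact Finset.prod_ne_zero_iff.2 fun f _ => hvert _

end pictures

/-! ### Counting algebraically independent slopes -/

section transcendence

variable {k K : Type*} [Field k] [Field K] [Algebra k K]

/-- Algebraically independent elements of a field generated by `S` are at most `|S|` in number. -/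
theorem card_le_of_forall_mem_adjoin {ι : Type*} [Fintype ι] {s : ι → K}
    (hs : AlgebraicIndependent k s) (S : Finset K)
    (h : ∀ i, s i ∈ IntermediateField.adjoin k (S : Set K)) : Fintype.card ι ≤ S.card := by
  let M := AlgebraicIndependent.matroid k K
  have hind : M.Indep (Set.range s) := hs.coe_range
  have hcl : Set.range s ⊆ M.closure S := by
    rintro _ ⟨i, rfl⟩
    rw [AlgebraicIndependent.matroid_closure_eq]
    obtain ⟨a, ha, b, hb, hab⟩ := IntermediateField.mem_adjoin_iff_div.1 (h i)
    rw [SetLike.mem_coe, Subalgebra.mem_algebraicClosure, hab, div_eq_mul_inv]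
    have hA : ∀ c ∈ Algebra.adjoin k (S : Set K), IsAlgebraic (Algebra.adjoin k (S : Set K)) c :=
      fun c hc => isAlgebraic_algebraMap (⟨c, hc⟩ : Algebra.adjoin k (S : Set K))
    exact (hA a ha).mul (hA b hb).inv
  have h1 : (Set.range s).encard ≤ (S : Set K).encard := by
    calc (Set.range s).encard ≤ M.eRk (M.closure S) := hind.encard_le_eRk_of_subset hcl
      _ = M.eRk S := M.eRk_closure_eq _
      _ ≤ _ := M.eRk_le_encard _
  rw [← Set.image_univ, hs.injective.encard_image, Set.encard_univ, Set.encard_coe_eq_coe_finsetCard,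
    ENat.card_eq_coe_fintype_card] at h1
  exact_mod_cast h1

variable {V : Type*} [Fintype V] {s : Sym2 V → K} {x y : V → K}

/-- The slopes of the lines joining `q` points depend on `2q - 3` parameters: normalize by a
translation and a homothety so that one edge vector starts at the origin and has abscissa `1`. -/
theorem card_add_three_le_of_slopes {H : Finset (Sym2 V)}
    (hs : AlgebraicIndependent k fun e : H => s e)
    (hp : ∀ v w, s(v, w) ∈ H → y w - y v = s s(v, w) * (x w - x v))
    (hne : ∀ v w, s(v, w) ∈ H → (x v, y v) ≠ (x w, y w))
    (hq : ∃ v w, (x v, y v) ≠ (x w, y w)) :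
    H.card + 3 ≤ 2 * (Finset.univ.image fun v => (x v, y v)).card := by
  set P := Finset.univ.image fun v => (x v, y v) with hP
  have hmem : ∀ v, (x v, y v) ∈ P := fun v => Finset.mem_image_of_mem _ (Finset.mem_univ v)
  have hxne : ∀ v w, s(v, w) ∈ H → x w - x v ≠ 0 := by
    intro v w hvw h0
    have h1 := hp v w hvw
    rw [h0, mul_zero] at h1
    exact hne v w hvw (Prod.ext (sub_eq_zero.1 h0).symm (sub_eq_zero.1 h1).symm)
  obtain ⟨a, b, hab⟩ := hq
  have hP2 : 2 ≤ P.card := Finset.one_lt_card.2 ⟨_, hmem a, _, hmem b, hab⟩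
  rcases H.eq_empty_or_nonempty with rfl | ⟨e₀, he₀⟩
  · rw [Finset.card_empty]; omega
  induction e₀ with | h v₀ w₀ =>
  have hd := hxne v₀ w₀ he₀
  set d := x w₀ - x v₀ with hddef
  let S : Finset K := (P.erase (x v₀, y v₀)).image (fun c => (c.2 - y v₀) / d)
    ∪ ((P.erase (x v₀, y v₀)).erase (x w₀, y w₀)).image (fun c => (c.1 - x v₀) / d)
  have hScard : S.card ≤ (P.card - 1) + (P.card - 1 - 1) := by
    refine (Finset.card_union_le _ _).trans (add_le_add ?_ ?_)
    · refine Finset.card_image_le.trans ?_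
      rw [Finset.card_erase_of_mem (hmem v₀)]
    · refine Finset.card_image_le.trans ?_
      rw [Finset.card_erase_of_mem
        (Finset.mem_erase.2 ⟨(hne v₀ w₀ he₀).symm, hmem w₀⟩), Finset.card_erase_of_mem (hmem v₀)]
  have hY : ∀ v, (y v - y v₀) / d ∈ IntermediateField.adjoin k (S : Set K) := by
    intro v
    by_cases h : (x v, y v) = (x v₀, y v₀)
    · rw [show y v = y v₀ from congrArg Prod.snd h, sub_self, zero_div]
      exact zero_mem _
    · refine IntermediateField.subset_adjoin _ _ (Finset.mem_union_left _ ?_)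
      exact Finset.mem_image.2 ⟨_, Finset.mem_erase.2 ⟨h, hmem v⟩, rfl⟩
  have hX : ∀ v, (x v - x v₀) / d ∈ IntermediateField.adjoin k (S : Set K) := by
    intro v
    by_cases h : (x v, y v) = (x v₀, y v₀)
    · rw [show x v = x v₀ from congrArg Prod.fst h, sub_self, zero_div]
      exact zero_mem _
    · by_cases h' : (x v, y v) = (x w₀, y w₀)
      · rw [show x v = x w₀ from congrArg Prod.fst h', div_self hd]
        exact one_mem _
      · refine IntermediateField.subset_adjoin _ _ (Finset.mem_union_right _ ?_)
        exact Finset.mem_image.2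
          ⟨_, Finset.mem_erase.2 ⟨h', Finset.mem_erase.2 ⟨h, hmem v⟩⟩, rfl⟩
  have hle := card_le_of_forall_mem_adjoin hs S (by
    rintro ⟨e, he⟩
    induction e with | h v w =>
    have h1 := hp v w he
    have h2 := hxne v w he
    have h3 : s s(v, w) = ((y w - y v₀) / d - (y v - y v₀) / d)
        / ((x w - x v₀) / d - (x v - x v₀) / d) := by
      rw [← sub_div, ← sub_div, sub_sub_sub_cancel_right, sub_sub_sub_cancel_right, h1]
      field_simp
    change s s(v, w) ∈ _
    rw [h3]
    exact div_mem (sub_mem (hY w) (hY v)) (sub_mem (hX w) (hX v)))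
  rw [Fintype.card_coe] at hle
  omega

/-- The edges of `H` with both endpoints in `U`. -/
noncomputable def inducedEdges (H : Finset (Sym2 V)) (U : Finset V) : Finset (Sym2 V) :=
  H.filter fun e => ∀ v ∈ e, v ∈ U

/-- Laman's condition, for proper vertex subsets: a set of `u ≥ 2` vertices, not all of `V`, spans
at most `2u - 3` edges. -/
def IsSparse (H : Finset (Sym2 V)) : Prop :=
  ∀ U : Finset V, U ≠ Finset.univ → 2 ≤ U.card → (inducedEdges H U).card + 3 ≤ 2 * U.card

/-- A sparse set of edges that admits a realization with algebraically independent slopes has at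
most `2n - 3` edges, and if it has that many then the points of the realization are distinct.
Sort the edges by the coincidences of points: by sparsity few edges are contracted to a point, and
the slopes of the others are bounded in number by the number of distinct points. -/
theorem card_add_three_le_of_isSparse {H : Finset (Sym2 V)} (hdiag : ∀ e ∈ H, ¬ e.IsDiag)
    (hH : IsSparse H) (hs : AlgebraicIndependent k fun e : H => s e)
    (hp : ∀ v w, s(v, w) ∈ H → y w - y v = s s(v, w) * (x w - x v))
    (hq : ∃ v w, (x v, y v) ≠ (x w, y w)) :
    H.card + 3 ≤ 2 * Fintype.card V ∧ (H.card + 3 = 2 * Fintype.card V →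
      Function.Injective fun v => (x v, y v)) := by
  set p : V → K × K := fun v => (x v, y v) with hpdef
  set P := Finset.univ.image p with hP
  let U : K × K → Finset V := fun c => Finset.univ.filter fun v => p v = c
  have hUuniv : ∀ c, U c ≠ Finset.univ := by
    obtain ⟨a, b, hab⟩ := hq
    intro c hc
    have ha : a ∈ U c := hc ▸ Finset.mem_univ a
    have hb : b ∈ U c := hc ▸ Finset.mem_univ b
    simp only [U, Finset.mem_filter, Finset.mem_univ, true_and] at ha hb
    exact hab (ha.trans hb.symm)
  have hU1 : ∀ c ∈ P, 1 ≤ (U c).card := by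
    intro c hc
    obtain ⟨v, -, hv⟩ := Finset.mem_image.1 hc
    exact Finset.card_pos.2 ⟨v, by simp [U, hv]⟩
  have hle : ∀ c ∈ P, (inducedEdges H (U c)).card + 2 ≤ 2 * (U c).card := by
    intro c hc
    rcases (hU1 c hc).lt_or_eq with h | h
    · have := hH (U c) (hUuniv c) h
      omega
    · have : inducedEdges H (U c) = ∅ := by
        obtain ⟨u, hu⟩ := Finset.card_eq_one.1 h.symm
        refine Finset.eq_empty_of_forall_notMem fun e he => ?_
        obtain ⟨heH, heU⟩ := Finset.mem_filter.1 he
        induction e with | h v w =>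
        have hv := heU v (Sym2.mem_mk_left _ _)
        have hw := heU w (Sym2.mem_mk_right _ _)
        rw [hu, Finset.mem_singleton] at hv hw
        exact hdiag _ heH (by rw [Sym2.mk_isDiag_iff, hv, hw])
      rw [this, Finset.card_empty]; omega
  -- `Hc` consists of the edges not contracted to a point.
  let Hc := H.filter fun e => ∀ c, ∃ v ∈ e, p v ≠ c
  have hcov : H ⊆ Hc ∪ P.biUnion fun c => inducedEdges H (U c) := by
    intro e he
    by_cases hc : ∀ c, ∃ v ∈ e, p v ≠ c
    · exact Finset.mem_union_left _ (Finset.mem_filter.2 ⟨he, hc⟩)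
    · push Not at hc
      obtain ⟨c, hc⟩ := hc
      refine Finset.mem_union_right _ (Finset.mem_biUnion.2 ⟨c, ?_, ?_⟩)
      · induction e with | h v w =>
        exact Finset.mem_image.2 ⟨v, Finset.mem_univ _, hc v (Sym2.mem_mk_left _ _)⟩
      · exact Finset.mem_filter.2 ⟨he, fun v hv => by simp [U, hc v hv]⟩
  have hcard : H.card ≤ Hc.card + ∑ c ∈ P, (inducedEdges H (U c)).card :=
    (Finset.card_le_card hcov).trans ((Finset.card_union_le _ _).trans
      (Nat.add_le_add_left Finset.card_biUnion_le _))
  have hVcard : Fintype.card V = ∑ c ∈ P, (U c).card :=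
    Finset.card_eq_sum_card_image p Finset.univ
  have hHc : Hc.card + 3 ≤ 2 * P.card := by
    refine card_add_three_le_of_slopes (k := k) (s := s) (x := x) (y := y)
      (hs.comp (fun e : Hc => (⟨e.1, (Finset.mem_filter.1 e.2).1⟩ : H)) fun e e' h => ?_)
      (fun v w h => hp v w (Finset.mem_filter.1 h).1) (fun v w h heq => ?_) hq
    · exact Subtype.ext (congrArg (fun z : H => (z : Sym2 V)) h)
    · obtain ⟨u, hu, hne⟩ := (Finset.mem_filter.1 h).2 (p v)
      rcases Sym2.mem_iff.1 hu with rfl | rfl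
      · exact hne rfl
      · exact hne heq.symm
  have hsum : ∑ c ∈ P, ((inducedEdges H (U c)).card + 2) ≤ ∑ c ∈ P, 2 * (U c).card :=
    Finset.sum_le_sum hle
  have e1 : ∑ c ∈ P, ((inducedEdges H (U c)).card + 2)
      = ∑ c ∈ P, (inducedEdges H (U c)).card + 2 * P.card := by
    rw [Finset.sum_add_distrib, Finset.sum_const, smul_eq_mul, mul_comm]
  have e2 : ∑ c ∈ P, 2 * (U c).card = 2 * Fintype.card V := by rw [← Finset.mul_sum, hVcard]
  refine ⟨by omega, fun heq v w hvw => ?_⟩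
  by_contra hne
  -- A point shared by two vertices would make the count strict.
  have hlt : ∑ c ∈ P, ((inducedEdges H (U c)).card + 2) < ∑ c ∈ P, 2 * (U c).card := by
    refine Finset.sum_lt_sum hle ⟨p v, Finset.mem_image_of_mem _ (Finset.mem_univ v), ?_⟩
    have h2 : 2 ≤ (U (p v)).card :=
      Finset.one_lt_card.2 ⟨v, by simp [U], w, Finset.mem_filter.2 ⟨Finset.mem_univ w, hvw.symm⟩, hne⟩
    have := hH (U (p v)) (hUuniv _) h2
    omega
  omega

end transcendence

/-! ### Realizations with generic slopes -/

section generic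

variable {V : Type*}

/-- The increment of a function along an edge, for an arbitrary orientation of each edge. -/
noncomputable def incr {R : Type*} [Ring R] (x : V → R) (e : Sym2 V) : R :=
  x (Quot.out e).2 - x (Quot.out e).1

theorem mk_out (e : Sym2 V) : s((Quot.out e).1, (Quot.out e).2) = e := Quot.out_eq e

theorem incr_mk_eq_or {R : Type*} [Ring R] (v w : V) :
    (∀ x : V → R, incr x s(v, w) = x w - x v) ∨ ∀ x : V → R, incr x s(v, w) = -(x w - x v) := by
  have := mk_out s(v, w)
  rw [Sym2.eq_iff] at this
  rcases this with ⟨h1, h2⟩ | ⟨h1, h2⟩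
  · exact Or.inl fun x => by rw [incr, h1, h2]
  · exact Or.inr fun x => by rw [incr, h1, h2, neg_sub]

theorem incr_eq_mul_iff {R : Type*} [Ring R] {c : R} {x y : V → R} {v w : V} :
    incr y s(v, w) = c * incr x s(v, w) ↔ y w - y v = c * (x w - x v) := by
  rcases incr_mk_eq_or (R := R) v w with h | h
  · rw [h, h]
  · rw [h, h, mul_neg, neg_inj]

variable {k K : Type*} [Field k] [Field K] [Algebra k K] {s : Sym2 V → K} {H : Finset (Sym2 V)}

/-- The linear equations `Δy = s Δx` of the realizations with slopes `s` of a sparse set of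
`2n - 3` edges are independent when `s` is generic, and leave, up to translation and homothety,
a single realization; its edges have nonzero length. -/
theorem exists_realization [Fintype V] (hdiag : ∀ e ∈ H, ¬ e.IsDiag) (hH : IsSparse H)
    (hcard : H.card + 3 = 2 * Fintype.card V)
    (hs : AlgebraicIndependent k fun e : H => s e) :
    (∃ x y : V → K, ∀ e ∈ H, incr y e = s e * incr x e ∧ incr x e ≠ 0) ∧
      ∀ c : Sym2 V → K, ∃ x y : V → K, ∀ e ∈ H, incr y e - s e * incr x e = c e := by
  have hne : H.Nonempty := Finset.card_pos.1 (by omega)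
  obtain ⟨e₀, he₀⟩ := hne
  induction e₀ with | h r a =>
  have hra : r ≠ a := fun h => hdiag _ he₀ h
  let Φ : (V → K) × (V → K) →ₗ[K] (H → K) × K × K × K :=
    { toFun := fun p => (fun e => incr p.2 e - s e * incr p.1 e, p.1 r, p.2 r, p.1 a)
      map_add' := fun p q => by
        ext
        · simp [incr]; ring
        all_goals simp
      map_smul' := fun c p => by
        ext
        · simp [incr]; ring
        all_goals simp }
  have hinj_of : ∀ x y : V → K, (∀ e ∈ H, incr y e = s e * incr x e) →
      (∃ v w, (x v, y v) ≠ (x w, y w)) → ∀ v w, s(v, w) ∈ H → x w - x v ≠ 0 := by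
    intro x y hxy hq v w hvw h0
    have hp : ∀ v w, s(v, w) ∈ H → y w - y v = s s(v, w) * (x w - x v) :=
      fun v w h => incr_eq_mul_iff.1 (hxy _ h)
    have hi := (card_add_three_le_of_isSparse hdiag hH hs hp hq).2 hcard
    have h1 := hp v w hvw
    rw [h0, mul_zero] at h1
    exact hdiag _ hvw (hi (Prod.ext (sub_eq_zero.1 h0).symm (sub_eq_zero.1 h1).symm))
  have hinj : Function.Injective Φ := by
    rw [← LinearMap.ker_eq_bot, LinearMap.ker_eq_bot']
    rintro ⟨x, y⟩ hxy
    have hpic : ∀ e ∈ H, incr y e = s e * incr x e := fun e he =>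
      sub_eq_zero.1 (congrFun (congrArg Prod.fst hxy) ⟨e, he⟩)
    have hxr : x r = 0 := congrArg (fun z => z.2.1) hxy
    have hyr : y r = 0 := congrArg (fun z => z.2.2.1) hxy
    have hxa : x a = 0 := congrArg (fun z => z.2.2.2) hxy
    by_contra hcon
    refine hinj_of x y hpic ?_ r a he₀ (by rw [hxr, hxa, sub_self])
    by_contra! hall
    refine hcon (Prod.ext (funext fun v => ?_) (funext fun v => ?_))
    · exact (congrArg Prod.fst (hall v r)).trans hxr
    · exact (congrArg Prod.snd (hall v r)).trans hyr
  have hdim : Module.finrank K ((V → K) × (V → K))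
      = Module.finrank K ((H → K) × K × K × K) := by
    simp only [Module.finrank_prod, Module.finrank_fintype_fun_eq_card, Fintype.card_coe,
      Module.finrank_self]
    omega
  have hsurj := (LinearMap.injective_iff_surjective_of_finrank_eq_finrank hdim).1 hinj
  constructor
  · obtain ⟨⟨x, y⟩, hxy⟩ := hsurj (0, 0, 0, 1)
    have hpic : ∀ e ∈ H, incr y e = s e * incr x e := fun e he =>
      sub_eq_zero.1 (congrFun (congrArg Prod.fst hxy) ⟨e, he⟩)
    have hxr : x r = 0 := congrArg (fun z => z.2.1) hxy
    have hxa : x a = 1 := congrArg (fun z => z.2.2.2) hxy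
    have hq : ∃ v w, (x v, y v) ≠ (x w, y w) :=
      ⟨r, a, fun h => zero_ne_one (hxr.symm.trans ((congrArg Prod.fst h).trans hxa))⟩
    refine ⟨x, y, fun e he => ⟨hpic e he, ?_⟩⟩
    exact hinj_of x y hpic hq _ _ (by rwa [mk_out])
  · intro c
    obtain ⟨⟨x, y⟩, hxy⟩ := hsurj (fun e => c e, 0, 0, 0)
    exact ⟨x, y, fun e he => congrFun (congrArg Prod.fst hxy) ⟨e, he⟩⟩

/-- Algebraically independent slopes on `H`; outside `H` the value is `0` and plays no role. -/
theorem exists_algebraicIndependent_slopes (k : Type*) [Field k] (H : Finset (Sym2 V)) :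
    ∃ s : Sym2 V → FractionRing (MvPolynomial H k), AlgebraicIndependent k fun e : H => s e := by
  refine ⟨fun e => if h : e ∈ H then algebraMap (MvPolynomial H k) _ (MvPolynomial.X ⟨e, h⟩)
    else 0, ?_⟩
  have h := (MvPolynomial.algebraicIndependent_X H k).map' (f := IsScalarTower.toAlgHom k
    (MvPolynomial H k) (FractionRing (MvPolynomial H k))) (IsFractionRing.injective _ _)
  convert h using 2 with e
  simp

/-! ### Algebraic independence and specialization -/

/-- Algebraic independence of fractions can be tested at a point where the denominators do not
vanish: the fractions live in the local ring of that point. -/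
theorem algebraicIndependent_div_of_specialization {R L ι : Type*} [CommRing R] [IsDomain R]
    [Algebra k R] [Field L] [Algebra R L] [IsFractionRing R L] [Algebra k L] [IsScalarTower k R L]
    (φ : R →ₐ[k] K) {a b : ι → R} (hb : ∀ i, φ (b i) ≠ 0)
    (h : AlgebraicIndependent k fun i => φ (a i) / φ (b i)) :
    AlgebraicIndependent k fun i => algebraMap R L (a i) / algebraMap R L (b i) := by
  let M : Submonoid R := (nonZeroDivisors K).comap φ
  have hM : M ≤ nonZeroDivisors R := fun d hd => mem_nonZeroDivisors_of_ne_zero fun h0 => by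
    have h1 : φ d ∈ nonZeroDivisors K := hd
    rw [h0, map_zero] at h1
    exact zero_notMem_nonZeroDivisors h1
  let m : ι → Localization M := fun i =>
    IsLocalization.mk' _ (a i) (⟨b i, mem_nonZeroDivisors_of_ne_zero (hb i)⟩ : M)
  let ψ : Localization M →ₐ[k] K := IsLocalization.liftAlgHom (M := M) (f := φ)
    fun d => (nonZeroDivisors.ne_zero d.2).isUnit
  obtain ⟨f, hf⟩ : ∃ f : R →ₐ[k] L, ∀ r, f r = algebraMap R L r :=
    ⟨IsScalarTower.toAlgHom k R L, fun _ => rfl⟩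
  have hfinj : Function.Injective f := fun c d h =>
    IsFractionRing.injective R L (by rwa [← hf, ← hf])
  have hfu : ∀ d : M, IsUnit (f d) := fun d =>
    Ne.isUnit fun h => nonZeroDivisors.ne_zero (hM d.2) (hfinj (h.trans (map_zero f).symm))
  let j : Localization M →ₐ[k] L := IsLocalization.liftAlgHom hfu
  have hψ : AlgebraicIndependent k m := by
    refine AlgebraicIndependent.of_comp ψ ?_
    convert h with i
    change IsLocalization.lift _ (IsLocalization.mk' _ _ _) = _
    rw [IsLocalization.lift_mk'_spec]
    exact (mul_div_cancel₀ _ (hb i)).symm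
  have hj : Function.Injective j := by
    change Function.Injective (IsLocalization.lift _)
    rw [IsLocalization.lift_injective_iff]
    intro c d
    rw [(IsLocalization.injective (Localization M) hM).eq_iff]
    exact hfinj.eq_iff.symm
  convert hψ.map' hj with i
  change _ = IsLocalization.lift _ (IsLocalization.mk' _ _ _)
  rw [eq_comm, IsLocalization.lift_mk'_spec]
  rw [← hf, ← hf]
  refine (mul_div_cancel₀ _ fun h0 => hb i ?_).symm
  have hb0 : b i = 0 := hfinj (h0.trans (map_zero f).symm)
  rw [hb0, map_zero]

/-! ### The slopes of the edges as rational functions -/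

variable (V k) in
/-- The field of rational functions in the coordinates of the points of a realization. -/
abbrev CoordField : Type _ := FractionRing (MvPolynomial (V × Fin 2) k)

variable (k) in
/-- The `i`-th coordinate of the vertex `v`, as a rational function. -/
noncomputable def coord (i : Fin 2) (v : V) : CoordField V k :=
  algebraMap (MvPolynomial (V × Fin 2) k) _ (MvPolynomial.X (v, i))

theorem coord_injective (i : Fin 2) : Function.Injective (coord k i : V → CoordField V k) := by
  intro v w h
  have := MvPolynomial.X_injective (IsFractionRing.injective (MvPolynomial (V × Fin 2) k) _ h)
  exact congrArg Prod.fst this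

variable (k) in
/-- The slope of an edge, as a rational function of the coordinates of its endpoints. -/
noncomputable def coordSlope (e : Sym2 V) : CoordField V k :=
  incr (coord k 1) e / incr (coord k 0) e

/-- Specialize the coordinates to those of a realization with algebraically independent slopes. -/
theorem algebraicIndependent_coordSlope [Fintype V] (hdiag : ∀ e ∈ H, ¬ e.IsDiag)
    (hH : IsSparse H) (hcard : H.card + 3 = 2 * Fintype.card V) :
    AlgebraicIndependent k fun e : H => coordSlope k (e : Sym2 V) := by
  obtain ⟨s, hs⟩ := exists_algebraicIndependent_slopes k H
  obtain ⟨⟨x, y, hxy⟩, -⟩ := exists_realization hdiag hH hcard hs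
  let φ : MvPolynomial (V × Fin 2) k →ₐ[k] FractionRing (MvPolynomial H k) :=
    MvPolynomial.aeval fun p => if p.2 = 0 then x p.1 else y p.1
  let X : Fin 2 → V → MvPolynomial (V × Fin 2) k := fun i v => MvPolynomial.X (v, i)
  have hφ0 : ∀ e, φ (incr (X 0) e) = incr x e := fun e => by simp [φ, X, incr]
  have hφ1 : ∀ e, φ (incr (X 1) e) = incr y e := fun e => by simp [φ, X, incr]
  have h := algebraicIndependent_div_of_specialization (L := CoordField V k) φ
    (a := fun e : H => incr (X 1) (e : Sym2 V)) (b := fun e : H => incr (X 0) (e : Sym2 V))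
    (fun e => by rw [hφ0]; exact (hxy e e.2).2) (by
      have : (fun e : H => φ (incr (X 1) (e : Sym2 V)) / φ (incr (X 0) (e : Sym2 V)))
          = fun e : H => s e := by
        funext e
        rw [hφ0, hφ1, (hxy e e.2).1, mul_div_cancel_right₀ _ (hxy e e.2).2]
      rwa [this])
  have heq : (fun e : H => coordSlope k (e : Sym2 V)) = fun e : H =>
      algebraMap (MvPolynomial (V × Fin 2) k) (CoordField V k) (incr (X 1) (e : Sym2 V))
        / algebraMap _ _ (incr (X 0) (e : Sym2 V)) := by
    funext e
    simp only [coordSlope, incr, map_sub]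
    rfl
  rwa [heq]

end generic

/-! ### The Jacobian criterion and generic rigidity -/

section jacobian

variable {K : Type*} [Field K] {ι J : Type*}

theorem totalDegree_pderiv_lt {P : MvPolynomial ι K} {n : ℕ} (hP : P.totalDegree ≤ n + 1) (i : ι) :
    (MvPolynomial.pderiv i P).totalDegree ≤ n := by
  rw [MvPolynomial.totalDegree, Finset.sup_le_iff]
  intro m hm
  rw [MvPolynomial.mem_support_iff, MvPolynomial.coeff_pderiv] at hm
  have h1 : m + Finsupp.single i 1 ∈ P.support :=
    MvPolynomial.mem_support_iff.2 (left_ne_zero_of_mul hm)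
  have h2 := (MvPolynomial.le_totalDegree h1).trans hP
  rw [Finsupp.sum_add_index' (by simp) (by simp), Finsupp.sum_single_index rfl] at h2
  omega

theorem totalDegree_eq_zero_of_pderiv [CharZero K] {P : MvPolynomial ι K}
    (h : ∀ i, MvPolynomial.pderiv i P = 0) : P.totalDegree = 0 := by
  rw [MvPolynomial.totalDegree_eq_zero_iff]
  intro m hm i
  by_contra hmi
  have h1 := congrArg (MvPolynomial.coeff (m - Finsupp.single i 1)) (h i)
  rw [MvPolynomial.coeff_pderiv, MvPolynomial.coeff_zero, tsub_add_cancel_of_le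
    (Finsupp.single_le_iff.2 (Nat.one_le_iff_ne_zero.2 hmi))] at h1
  rcases mul_eq_zero.1 h1 with h2 | h2
  · exact MvPolynomial.mem_support_iff.1 hm h2
  · exact Nat.cast_add_one_ne_zero _ h2

theorem pderiv_aeval [Fintype ι] (f : ι → MvPolynomial J K) (P : MvPolynomial ι K) (j : J) :
    MvPolynomial.pderiv j (MvPolynomial.aeval f P)
      = ∑ i, MvPolynomial.aeval f (MvPolynomial.pderiv i P) * MvPolynomial.pderiv j (f i) := by
  induction P using MvPolynomial.induction_on with
  | C a => simp
  | add p q hp hq => simp only [map_add, hp, hq, add_mul, Finset.sum_add_distrib]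
  | mul_X p n hp =>
    simp only [map_mul, MvPolynomial.aeval_X, MvPolynomial.pderiv_mul, hp, map_add, add_mul,
      Finset.sum_add_distrib, Finset.sum_mul]
    congr 1
    · exact Finset.sum_congr rfl fun i _ => by ring
    · rw [Finset.sum_eq_single n]
      · simp
      · intro i _ hi
        simp [MvPolynomial.pderiv_X_of_ne hi.symm]
      · simp

/-- The Jacobian criterion in characteristic zero, tested at a point: polynomials whose
differentials at some point `p` are linearly independent are algebraically independent. The linear
independence is given in the form of vectors `b i'` dual to the differentials. By the chain rule, the
partial derivatives of an algebraic relation are again relations, of smaller degree. -/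
theorem algebraicIndependent_of_jacobian [CharZero K] [Fintype ι] [Fintype J]
    {f : ι → MvPolynomial J K} (p : J → K) (b : ι → J → K)
    (h : ∀ i i', ∑ j, MvPolynomial.eval p (MvPolynomial.pderiv j (f i)) * b i' j
      = if i = i' then 1 else 0) : AlgebraicIndependent K f := by
  let D : Matrix ι ι (MvPolynomial J K) := Matrix.of fun i i' =>
    ∑ j, MvPolynomial.pderiv j (f i) * MvPolynomial.C (b i' j)
  have hD : D.det ≠ 0 := by
    intro h0
    have h1 := congrArg (MvPolynomial.eval p) h0
    rw [RingHom.map_det, map_zero] at h1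
    have h2 : (MvPolynomial.eval p).mapMatrix D = 1 := by
      ext i i'
      simp only [D, RingHom.mapMatrix_apply, Matrix.map_apply, Matrix.of_apply, map_sum, map_mul,
        MvPolynomial.eval_C, h, Matrix.one_apply]
    rw [h2, Matrix.det_one] at h1
    exact one_ne_zero h1
  have main : ∀ n (P : MvPolynomial ι K), P.totalDegree ≤ n → MvPolynomial.aeval f P = 0 →
      P = 0 := by
    intro n
    induction n with
    | zero =>
      intro P hP h0
      rw [MvPolynomial.totalDegree_eq_zero_iff_eq_C.1 (Nat.le_zero.1 hP)] at h0 ⊢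
      rw [MvPolynomial.aeval_C, MvPolynomial.algebraMap_eq, MvPolynomial.C_eq_zero] at h0
      rw [h0, map_zero]
    | succ n ih =>
      intro P hP h0
      have hu : Matrix.vecMul (fun i => MvPolynomial.aeval f (MvPolynomial.pderiv i P)) D = 0 := by
        funext i'
        simp only [Matrix.vecMul, dotProduct, D, Matrix.of_apply, Finset.mul_sum, Pi.zero_apply]
        rw [Finset.sum_comm]
        refine Finset.sum_eq_zero fun j _ => ?_
        simp_rw [← mul_assoc]
        rw [← Finset.sum_mul, ← pderiv_aeval, h0, map_zero, zero_mul]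
      have hu0 := Matrix.eq_zero_of_vecMul_eq_zero hD hu
      have hpd : ∀ i, MvPolynomial.pderiv i P = 0 := fun i =>
        ih _ (totalDegree_pderiv_lt hP i) (congrFun hu0 i)
      have hC := MvPolynomial.totalDegree_eq_zero_iff_eq_C.1 (totalDegree_eq_zero_of_pderiv hpd)
      rw [hC] at h0 ⊢
      rw [MvPolynomial.aeval_C, MvPolynomial.algebraMap_eq, MvPolynomial.C_eq_zero] at h0
      rw [h0, map_zero]
  exact algebraicIndependent_iff.2 fun P hP => main _ P le_rfl hP

end jacobian

section rigidity

variable {V : Type*} {H : Finset (Sym2 V)}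

theorem squaredLength_eq (e : Sym2 V) :
    squaredLength e = incr (fun v => MvPolynomial.X (v, 0)) e ^ 2
      + incr (fun v => MvPolynomial.X (v, 1)) e ^ 2 := by
  induction e with | h v w =>
  rcases incr_mk_eq_or (R := MvPolynomial (V × Fin 2) ℚ) v w with h | h <;>
  · rw [h, h, squaredLength, Sym2.lift_mk]
    ring

variable [Fintype V]

/-- The derivative of the squared length of `e` at the realization `(x, y)` in the direction
`(x', y')`. -/
theorem sum_pderiv_map_squaredLength {K : Type*} [Field K] [Algebra ℚ K] (x y x' y' : V → K)
    (e : Sym2 V) :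
    ∑ j, MvPolynomial.eval (fun p : V × Fin 2 => if p.2 = 0 then x p.1 else y p.1)
        (MvPolynomial.pderiv j (MvPolynomial.map (algebraMap ℚ K) (squaredLength e)))
        * (if j.2 = 0 then x' j.1 else y' j.1)
      = 2 * (incr x e * incr x' e + incr y e * incr y' e) := by
  set p : V × Fin 2 → K := fun p => if p.2 = 0 then x p.1 else y p.1
  set b : V × Fin 2 → K := fun p => if p.2 = 0 then x' p.1 else y' p.1
  have hX : ∀ i, ∑ j, MvPolynomial.eval p (MvPolynomial.pderiv j (MvPolynomial.X i)) * b j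
      = b i := by
    intro i
    rw [Finset.sum_eq_single i]
    · simp
    · intro j _ hj
      simp [MvPolynomial.pderiv_X_of_ne hj.symm]
    · simp
  have hsq : ∀ i i', ∑ j, MvPolynomial.eval p
      (MvPolynomial.pderiv j ((MvPolynomial.X i - MvPolynomial.X i') ^ 2)) * b j
      = 2 * ((p i - p i') * (b i - b i')) := by
    intro i i'
    rw [← hX i, ← hX i', ← Finset.sum_sub_distrib, Finset.mul_sum, Finset.mul_sum]
    refine Finset.sum_congr rfl fun j _ => ?_
    simp only [MvPolynomial.pderiv_pow, map_mul, map_sub, MvPolynomial.eval_X, map_natCast,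
      map_pow]
    push_cast
    ring
  change ∑ j, MvPolynomial.eval p _ * b j = _
  rw [squaredLength_eq]
  simp only [incr, map_add, map_pow, map_sub, MvPolynomial.map_X, add_mul, Finset.sum_add_distrib,
    hsq]
  rw [mul_add]
  rfl

/-- Sparse sets of `2n - 3` edges are independent in the rigidity matroid: at a realization with
generic slopes, solving the linear equations for the slopes provides vectors dual to the
differentials of the squared lengths. -/
theorem algebraicIndependent_squaredLength (hdiag : ∀ e ∈ H, ¬ e.IsDiag) (hH : IsSparse H)
    (hcard : H.card + 3 = 2 * Fintype.card V) :
    AlgebraicIndependent ℚ fun e : H => squaredLength (e : Sym2 V) := by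
  obtain ⟨K, _, _, s, hs⟩ : ∃ (K : Type _) (_ : Field K) (_ : Algebra ℚ K) (s : Sym2 V → K),
      AlgebraicIndependent ℚ fun e : H => s e :=
    ⟨_, inferInstance, _, exists_algebraicIndependent_slopes ℚ H⟩
  obtain ⟨⟨x, y, hxy⟩, hsurj⟩ := exists_realization hdiag hH hcard hs
  have : CharZero K := algebraRat.charZero K
  have hJ : AlgebraicIndependent K fun e : H =>
      MvPolynomial.map (algebraMap ℚ K) (squaredLength (e : Sym2 V)) := by
    -- The form `Δx Δx' + Δy Δy'` at the velocity `(y', -x')` is, for `Δy = s Δx`, the multiple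
    -- `Δx (Δy' - s Δx')` of the form that defines realizations.
    choose x' y' hxy' using fun e₀ : H =>
      hsurj fun e => if e = e₀ then 1 / (2 * incr x e) else 0
    refine algebraicIndependent_of_jacobian
      (fun p : V × Fin 2 => if p.2 = 0 then x p.1 else y p.1)
      (fun e₀ p => if p.2 = 0 then y' e₀ p.1 else - x' e₀ p.1) fun e e₀ => ?_
    rw [sum_pderiv_map_squaredLength x y (y' e₀) (fun v => - x' e₀ v)]
    have h1 := hxy' e₀ e e.2
    have h2 := hxy e e.2
    have h3 : incr (fun v => - x' e₀ v) (e : Sym2 V) = - incr (x' e₀) e := by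
      simp only [incr]; ring
    rw [h3, h2.1]
    calc _ = 2 * incr x (e : Sym2 V) * (incr (y' e₀) e - s e * incr (x' e₀) e) := by ring
      _ = _ := by
        rw [h1]
        have h4 := h2.2
        by_cases he : e = e₀
        · rw [if_pos he, if_pos (congrArg _ he)]
          field_simp
        · rw [if_neg he, if_neg fun h => he (Subtype.ext h), mul_zero]
  refine AlgebraicIndependent.of_ringHom_of_comp_eq (algebraMap ℚ K)
    (MvPolynomial.map (algebraMap ℚ K)) hJ (algebraMap ℚ K).injective ?_
  ext
  simp

end rigidity

/-! ### Rigidity circuits and sparsity -/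

section circuits

variable {V : Type*} {H : Finset (Sym2 V)}

/-- The squared lengths of the edges among `u` points depend on `2u - 3` parameters: take the
origin at one of the points, and measure the dot and cross products with the vector to another. -/
theorem card_add_three_le_of_squaredLength {U : Finset V} (hU : 2 ≤ U.card)
    (hHU : ∀ e ∈ H, ∀ v ∈ e, v ∈ U)
    (h : AlgebraicIndependent ℚ fun e : H => squaredLength (e : Sym2 V)) :
    H.card + 3 ≤ 2 * U.card := by
  obtain ⟨v₀, hv₀, v₁, hv₁, hne⟩ := Finset.one_lt_card.1 hU
  let X : Fin 2 → V → CoordField V ℚ := fun i v => coord ℚ i v - coord ℚ i v₀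
  let N : CoordField V ℚ := X 0 v₁ ^ 2 + X 1 v₁ ^ 2
  have hN : N ≠ 0 := by
    intro h0
    have h1 : algebraMap (MvPolynomial (V × Fin 2) ℚ) (CoordField V ℚ)
        ((MvPolynomial.X (v₁, 0) - MvPolynomial.X (v₀, 0)) ^ 2
          + (MvPolynomial.X (v₁, 1) - MvPolynomial.X (v₀, 1)) ^ 2) = 0 := by
      rw [← h0]
      simp [N, X, coord]
    rw [map_eq_zero_iff _ (IsFractionRing.injective _ _)] at h1
    have h2 := congrArg (MvPolynomial.eval fun p : V × Fin 2 => if p.1 = v₁ then (1 : ℚ) else 0) h1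
    norm_num [hne] at h2
  let c : V → CoordField V ℚ := fun v => X 0 v * X 0 v₁ + X 1 v * X 1 v₁
  let d : V → CoordField V ℚ := fun v => X 0 v * X 1 v₁ - X 1 v * X 0 v₁
  let S : Finset (CoordField V ℚ) := (U.erase v₀).image c ∪ ((U.erase v₀).erase v₁).image d
  have hScard : S.card ≤ (U.card - 1) + (U.card - 1 - 1) := by
    refine (Finset.card_union_le _ _).trans (add_le_add ?_ ?_)
    · refine Finset.card_image_le.trans ?_
      rw [Finset.card_erase_of_mem hv₀]
    · refine Finset.card_image_le.trans ?_
      rw [Finset.card_erase_of_mem (Finset.mem_erase.2 ⟨hne.symm, hv₁⟩),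
        Finset.card_erase_of_mem hv₀]
  have hc : ∀ v ∈ U, c v ∈ IntermediateField.adjoin ℚ (S : Set (CoordField V ℚ)) := by
    intro v hv
    by_cases h : v = v₀
    · have : c v = 0 := by simp [c, X, h]
      rw [this]
      exact zero_mem _
    · exact IntermediateField.subset_adjoin _ _ (Finset.mem_union_left _
        (Finset.mem_image_of_mem _ (Finset.mem_erase.2 ⟨h, hv⟩)))
  have hd : ∀ v ∈ U, d v ∈ IntermediateField.adjoin ℚ (S : Set (CoordField V ℚ)) := by
    intro v hv
    by_cases h : v = v₀
    · have : d v = 0 := by simp [d, X, h]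
      rw [this]
      exact zero_mem _
    · by_cases h' : v = v₁
      · have : d v = 0 := by simp only [d, h']; ring
        rw [this]
        exact zero_mem _
      · exact IntermediateField.subset_adjoin _ _ (Finset.mem_union_right _
          (Finset.mem_image_of_mem _ (Finset.mem_erase.2 ⟨h', Finset.mem_erase.2 ⟨h, hv⟩⟩)))
  have hNc : N = c v₁ := by simp only [N, c]; ring
  have h' := h.map' (f := IsScalarTower.toAlgHom ℚ (MvPolynomial (V × Fin 2) ℚ) (CoordField V ℚ))
    (IsFractionRing.injective _ _)
  have hle := card_le_of_forall_mem_adjoin h' S (by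
    rintro ⟨e, he⟩
    induction e with | h v w =>
    have hv := hHU _ he v (Sym2.mem_mk_left _ _)
    have hw := hHU _ he w (Sym2.mem_mk_right _ _)
    have h1 : (IsScalarTower.toAlgHom ℚ (MvPolynomial (V × Fin 2) ℚ) (CoordField V ℚ))
        (squaredLength s(v, w)) = ((c v - c w) ^ 2 + (d v - d w) ^ 2) / N := by
      rw [eq_div_iff hN]
      have : (IsScalarTower.toAlgHom ℚ (MvPolynomial (V × Fin 2) ℚ) (CoordField V ℚ))
        (squaredLength s(v, w)) = (X 0 v - X 0 w) ^ 2 + (X 1 v - X 1 w) ^ 2 := by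
        simp [squaredLength, X, coord]
      rw [this]
      simp only [N, c, d]
      ring
    change (IsScalarTower.toAlgHom ℚ (MvPolynomial (V × Fin 2) ℚ) (CoordField V ℚ))
        (squaredLength s(v, w)) ∈ _
    rw [h1, hNc]
    exact div_mem (add_mem (pow_mem (sub_mem (hc v hv) (hc w hw)) 2)
      (pow_mem (sub_mem (hd v hv) (hd w hw)) 2)) (hc v₁ hv₁))
  rw [Fintype.card_coe] at hle
  omega

theorem lengthRigidityMatroid_indep_iff :
    (lengthRigidityMatroid V).Indep H ↔ (∀ e ∈ H, ¬ e.IsDiag) ∧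
      AlgebraicIndependent ℚ fun e : H => squaredLength (e : Sym2 V) := by
  rw [lengthRigidityMatroid, Matroid.comapOn_indep_iff, AlgebraicIndependent.matroid_indep_iff]
  have hsub : ((H : Set (Sym2 V)) ⊆ (⊤ : SimpleGraph V).edgeSet) ↔ ∀ e ∈ H, ¬ e.IsDiag := by
    simp [Set.subset_def]
  rw [hsub]
  constructor
  · rintro ⟨h1, h2, h3⟩
    exact ⟨h3, (algebraicIndependent_image h2).2 h1⟩
  · rintro ⟨h3, h1⟩
    have h2 : Set.InjOn squaredLength (H : Set (Sym2 V)) := fun a ha b hb hab =>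
      congrArg Subtype.val (h1.injective (a₁ := ⟨a, ha⟩) (a₂ := ⟨b, hb⟩) hab)
    exact ⟨(algebraicIndependent_image h2).1 h1, h2, h3⟩

variable [Fintype V] {G : SimpleGraph V}

theorem exists_mem_notMem_inducedEdges (hconn : G.Connected) (hn : 2 ≤ Fintype.card V)
    {U : Finset V} (hU : U ≠ Finset.univ) :
    ∃ e ∈ G.edgeFinset, e ∉ inducedEdges G.edgeFinset U := by
  have : Nontrivial V := Fintype.one_lt_card_iff_nontrivial.1 hn
  obtain ⟨v, hv⟩ : ∃ v, v ∉ U := by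
    by_contra! h
    exact hU (Finset.eq_univ_of_forall h)
  obtain ⟨w, hw⟩ := hconn.preconnected.exists_adj_of_nontrivial v
  exact ⟨s(v, w), by simpa using hw,
    fun h => hv ((Finset.mem_filter.1 h).2 v (Sym2.mem_mk_left _ _))⟩

theorem not_isDiag_of_mem_edgeFinset : ∀ e ∈ G.edgeFinset, ¬ e.IsDiag := fun _ he =>
  G.not_isDiag_of_mem_edgeSet (SimpleGraph.mem_edgeFinset.1 he)

theorem IsSparse.mono {H H' : Finset (Sym2 V)} (hH : IsSparse H) (h : H' ⊆ H) : IsSparse H' :=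
  fun U hU hU2 => (Nat.add_le_add_right
    (Finset.card_le_card (Finset.filter_subset_filter _ h)) 3).trans (hH U hU hU2)

/-- Laman's theorem for circuits: a connected graph with `2n - 2` edges is a rigidity circuit if and
only if its proper vertex subsets of size `u ≥ 2` span at most `2u - 3` edges. -/
theorem isRigidityCircuit_iff_isSparse (hconn : G.Connected) (hn : 2 ≤ Fintype.card V)
    (hE : G.edgeFinset.card + 2 = 2 * Fintype.card V) :
    IsRigidityCircuit G ↔ IsSparse G.edgeFinset := by
  rw [IsRigidityCircuit, Matroid.isCircuit_iff_dep_forall_sdiff_singleton_indep,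
    ← SimpleGraph.coe_edgeFinset]
  constructor
  · rintro ⟨-, h⟩ U hU hU2
    obtain ⟨e, he, heU⟩ := exists_mem_notMem_inducedEdges hconn hn hU
    have h1 : (lengthRigidityMatroid V).Indep (inducedEdges G.edgeFinset U) :=
      (h e he).subset fun f hf => ⟨(Finset.mem_filter.1 hf).1, fun h => heU (h ▸ hf)⟩
    exact card_add_three_le_of_squaredLength hU2 (fun f hf => (Finset.mem_filter.1 hf).2)
      (lengthRigidityMatroid_indep_iff.1 h1).2
  · intro h
    refine ⟨⟨fun hind => ?_, ?_⟩, fun e he => ?_⟩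
    · have := card_add_three_le_of_squaredLength (U := Finset.univ) hn (fun _ _ _ _ =>
        Finset.mem_univ _) (lengthRigidityMatroid_indep_iff.1 hind).2
      rw [Finset.card_univ] at this
      omega
    · rw [SimpleGraph.coe_edgeFinset]
      exact SimpleGraph.edgeSet_subset_edgeSet.2 le_top
    · rw [← Finset.coe_erase, lengthRigidityMatroid_indep_iff]
      have hd : ∀ f ∈ G.edgeFinset.erase e, ¬ f.IsDiag := fun f hf =>
        not_isDiag_of_mem_edgeFinset f (Finset.mem_of_mem_erase hf)
      refine ⟨hd, algebraicIndependent_squaredLength hd (h.mono (Finset.erase_subset _ _)) ?_⟩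
      rw [Finset.card_erase_of_mem he]
      omega

end circuits

/-! ### Irreducibility -/

section irreducible

variable {V : Type*} {G : SimpleGraph V}

theorem card_add_one_le_of_isAcyclic [Fintype V] [Nonempty V] {F : Finset G.edgeSet}
    (hF : (edgeGraph F).IsAcyclic) :
    F.card + 1 ≤ Fintype.card V ∧ (F.card + 1 = Fintype.card V → IsSpanningTree F) := by
  obtain ⟨T, hFT, -, hT⟩ :=
    (SimpleGraph.connected_top (V := V)).exists_isTree_le_of_le_of_isAcyclic le_top hF
  have h1 := (SimpleGraph.isTree_iff_connected_and_card.1 hT).2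
  have hsub : (edgeGraph F).edgeSet ⊆ T.edgeSet := SimpleGraph.edgeSet_subset_edgeSet.2 hFT
  have h2 : Nat.card (edgeGraph F).edgeSet ≤ Nat.card T.edgeSet :=
    Nat.card_mono (Set.toFinite _) hsub
  rw [Nat.card_eq_fintype_card (α := V)] at h1
  rw [card_edgeSet_edgeGraph] at h2
  refine ⟨by omega, fun h => ?_⟩
  have h3 : (edgeGraph F).edgeSet = T.edgeSet :=
    Set.eq_of_subset_of_ncard_le hsub (by
      rw [← Nat.card_coe_set_eq, ← Nat.card_coe_set_eq, card_edgeSet_edgeGraph]; omega)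
  rw [IsSpanningTree, SimpleGraph.edgeSet_inj.1 h3]
  exact hT

variable [Fintype V]

/-- If a union of two disjoint spanning trees has a vertex set `U` spanning at least `2|U| - 2`
edges, then both trees restrict to spanning trees of the induced subgraph. -/
theorem isRigidityPseudocircuit_induce {S : Finset G.edgeSet} (hS : IsCoupled S) {U : Finset V}
    (hU : U.Nonempty) (hc : 2 * U.card < (inducedEdges G.edgeFinset U).card + 3) :
    IsRigidityPseudocircuit ((⊤ : G.Subgraph).induce (U : Set V)).coe := by
  set G' := (⊤ : G.Subgraph).induce (U : Set V) with hG'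
  have : Nonempty G'.verts := ⟨⟨hU.choose, hU.choose_spec⟩⟩
  have hV : Fintype.card G'.verts = U.card := by
    convert Fintype.card_coe U using 1
    exact Fintype.card_congr (Equiv.refl _)
  have hacyc : ∀ F : Finset G.edgeSet, (edgeGraph F).IsAcyclic →
      (edgeGraph (Finset.univ.filter fun e => G'.hom.mapEdgeSet e ∈ F)).IsAcyclic := by
    intro F hF
    refine hF.comap ⟨Subtype.val, fun {v w} hvw => ?_⟩ Subtype.val_injective
    obtain ⟨h, hm⟩ := edgeGraph_adj.1 hvw
    exact edgeGraph_adj.2 ⟨G'.hom.map_adj h, (Finset.mem_filter.1 hm).2⟩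
  have hcompl : (Finset.univ.filter fun e => G'.hom.mapEdgeSet e ∈ S)ᶜ
      = Finset.univ.filter fun e => G'.hom.mapEdgeSet e ∈ Sᶜ := by
    ext e; simp
  have h1 := card_add_one_le_of_isAcyclic (hacyc S hS.1.isAcyclic)
  have h2 := card_add_one_le_of_isAcyclic (hacyc Sᶜ hS.2.isAcyclic)
  have h3 := Finset.card_add_card_compl (Finset.univ.filter fun e => G'.hom.mapEdgeSet e ∈ S)
  have h4 : (inducedEdges G.edgeFinset U).card ≤ Fintype.card G'.coe.edgeSet := by
    have hsub : inducedEdges G.edgeFinset U ⊆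
        (Finset.univ : Finset G'.coe.edgeSet).image fun e => (G'.hom.mapEdgeSet e : Sym2 V) := by
      intro e he
      obtain ⟨heG, heU⟩ := Finset.mem_filter.1 he
      induction e with | h v w =>
      have hv := heU v (Sym2.mem_mk_left _ _)
      have hw := heU w (Sym2.mem_mk_right _ _)
      have hadj : G'.coe.Adj ⟨v, hv⟩ ⟨w, hw⟩ := by
        simpa [hG', hv, hw] using heG
      exact Finset.mem_image.2 ⟨⟨s(⟨v, hv⟩, ⟨w, hw⟩), hadj⟩, Finset.mem_univ _, rfl⟩
    exact (Finset.card_le_card hsub).trans Finset.card_image_le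
  rw [← hcompl] at h2
  have hs1 := h1.2 (by omega)
  have hs2 := h2.2 (by omega)
  exact ⟨_, hs1, by convert hs2⟩

theorem exists_equiv_of_isCoupled {S : Finset G.edgeSet} (hS : IsCoupled S) :
    Nonempty ({f // f ∈ S} ≃ {e // e ∉ S}) := by
  refine ⟨Fintype.equivOfCardEq ?_⟩
  have h1 := hS.1.card_add_one
  have h2 := hS.2.card_add_one
  have h3 : Fintype.card {e // e ∉ S} = Sᶜ.card := by
    rw [← Fintype.card_coe]
    exact Fintype.card_congr (Equiv.subtypeEquivRight fun e => by simp)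
  rw [h3, Fintype.card_coe]
  omega

instance (G : SimpleGraph V) : Nonempty (EdgeOrientation G) := by
  have h : ∀ e : G.edgeSet, ∃ d : G.Dart, d.edge = e := by
    rintro ⟨e, he⟩
    induction e with | h v w => exact ⟨⟨(v, w), he⟩, rfl⟩
  choose d hd using h
  exact ⟨⟨d, hd⟩⟩

variable (T : SpanningTree G) (o : EdgeOrientation G)
  (σ : {f // f ∈ T.edges} ≃ {e // e ∉ T.edges})

/-- A vertex set that violates sparsity induces a pseudocircuit, whose tree polynomial is a divisor of
smaller positive degree. -/
theorem isSparse_of_irreducible {k : Type*} [Field k] [IsAlgClosed k]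
    (h : Irreducible (treePolynomial k T o σ)) : IsSparse G.edgeFinset := by
  intro U hU hU2
  by_contra hcon
  obtain ⟨S, hS⟩ := (treePolynomial_ne_zero_iff T o σ k).1 h.ne_zero
  have hG' := isRigidityPseudocircuit_induce hS (Finset.card_pos.1 (by omega)) (not_le.1 hcon)
  set G' := (⊤ : G.Subgraph).induce (U : Set V) with hG'def
  have hV : Fintype.card G'.verts = U.card := by
    convert Fintype.card_coe U using 1
    exact Fintype.card_congr (Equiv.refl _)
  obtain ⟨S', hS'⟩ := id hG'
  let T' : SpanningTree G'.coe := ⟨S', hS'.1⟩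
  obtain ⟨σ'⟩ := exists_equiv_of_isCoupled hS'
  obtain ⟨o'⟩ : Nonempty (EdgeOrientation G'.coe) := inferInstance
  have hinj := SimpleGraph.Hom.mapEdgeSet.injective G'.hom G'.hom_injective
  obtain ⟨q, hq⟩ := rename_treePolynomial_dvd (k := k) T o σ G' hG' T' o' σ'
  have hne' := (treePolynomial_ne_zero_iff T' o' σ' k).2 hG'
  have hren : MvPolynomial.rename G'.hom.mapEdgeSet (treePolynomial k T' o' σ') ≠ 0 := by
    rwa [Ne, map_eq_zero_iff _ (MvPolynomial.rename_injective _ hinj)]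
  have hdeg' : (MvPolynomial.rename G'.hom.mapEdgeSet
      (treePolynomial k T' o' σ')).totalDegree = T'.edges.card :=
    ((isHomogeneous_treePolynomial T' o' σ' k).rename_isHomogeneous).totalDegree hren
  have hdeg := (isHomogeneous_treePolynomial T o σ k).totalDegree h.ne_zero
  have c1 := T.isSpanningTree.card_add_one
  have c2 := T'.isSpanningTree.card_add_one
  have c3 : U.card < Fintype.card V :=
    (Finset.card_lt_iff_ne_univ U).2 hU
  rcases h.isUnit_or_isUnit hq with hu | hu
  · have := (MvPolynomial.isUnit_iff_totalDegree_of_isReduced.1 hu).2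
    omega
  · have hq0 := (MvPolynomial.isUnit_iff_totalDegree_of_isReduced.1 hu).2
    rw [hq, MvPolynomial.totalDegree_mul_of_isDomain hren hu.ne_zero, hdeg', hq0] at hdeg
    omega

/-- Sparse graphs with `2n - 2` edges have too many edges for a realization with algebraically
independent slopes, so the tree polynomial does not vanish at such slopes. -/
theorem treePolynomial_ne_zero_of_isSparse (k : Type*) [Field k] (hS : IsSparse G.edgeFinset) :
    treePolynomial k T o σ ≠ 0 := by
  intro h0
  obtain ⟨s, hs⟩ := exists_algebraicIndependent_slopes k G.edgeFinset
  have h1 := aeval_treePolynomial T o σ (k := k) fun e => s (e : Sym2 V)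
  rw [h0, map_zero, eq_comm, pairDet_one_eq_zero_iff] at h1
  obtain ⟨x, y, ⟨v, w, hvw⟩, hxy⟩ := h1
  rw [o.diff_ext_iff] at hxy
  have h2 := (card_add_three_le_of_isSparse not_isDiag_of_mem_edgeFinset hS hs
    (fun v w h => hxy v w (SimpleGraph.mem_edgeFinset.1 h))
    ⟨v, w, fun h => hvw (congrArg Prod.fst h)⟩).1
  have h3 := card_edgeSet_of_equiv σ
  rw [← SimpleGraph.edgeFinset_card] at h3
  omega

/-- The tree polynomial is a relation between the slopes of the edges. -/
theorem aeval_coordSlope_treePolynomial (k : Type*) [Field k] (hn : 2 ≤ Fintype.card V) :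
    MvPolynomial.aeval (fun e : G.edgeSet => coordSlope k (e : Sym2 V)) (treePolynomial k T o σ)
      = 0 := by
  have : Nontrivial V := Fintype.one_lt_card_iff_nontrivial.1 hn
  obtain ⟨v, w, hvw⟩ := exists_pair_ne V
  rw [aeval_treePolynomial, pairDet_one_eq_zero_iff]
  refine ⟨coord k 0, coord k 1, ⟨v, w, fun h => hvw (coord_injective 0 h)⟩,
    o.diff_ext_iff.2 fun v w h => ?_⟩
  rw [← incr_eq_mul_iff, coordSlope, div_mul_cancel₀]
  intro h0
  rw [← zero_mul (incr (coord k 0) s(v, w)), incr_eq_mul_iff, zero_mul, sub_eq_zero] at h0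
  exact h.ne (coord_injective 0 h0).symm

/-- A relation between the slopes that omits an edge is trivial. -/
theorem eq_zero_of_aeval_coordSlope {k : Type*} [Field k] (hS : IsSparse G.edgeFinset)
    (hE : G.edgeFinset.card + 2 = 2 * Fintype.card V) {f : MvPolynomial G.edgeSet k}
    {e : G.edgeSet} (he : f.degreeOf e = 0)
    (hf : MvPolynomial.aeval (fun e : G.edgeSet => coordSlope k (e : Sym2 V)) f = 0) : f = 0 := by
  obtain ⟨q, rfl⟩ := MvPolynomial.exists_rename_eq_of_vars_subset_range f
    (Subtype.val : {a : G.edgeSet // a ≠ e} → G.edgeSet) Subtype.val_injective (by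
      intro a ha
      refine ⟨⟨a, ?_⟩, rfl⟩
      rintro rfl
      exact MvPolynomial.mem_vars_iff_degreeOf_ne_zero.1 ha he)
  have hmem : (e : Sym2 V) ∈ G.edgeFinset := SimpleGraph.mem_edgeFinset.2 e.2
  have hc : (G.edgeFinset.erase (e : Sym2 V)).card + 3 = 2 * Fintype.card V := by
    have := Finset.card_pos.2 ⟨_, hmem⟩
    rw [Finset.card_erase_of_mem hmem]
    omega
  have hind := algebraicIndependent_coordSlope (k := k) (H := G.edgeFinset.erase e)
    (fun f hf => not_isDiag_of_mem_edgeFinset f (Finset.mem_of_mem_erase hf))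
    (hS.mono (Finset.erase_subset _ _)) hc
  have hind' := hind.comp (fun a : {a : G.edgeSet // a ≠ e} =>
    ⟨a.1.1, Finset.mem_erase.2 ⟨fun h => a.2 (Subtype.ext h), SimpleGraph.mem_edgeFinset.2 a.1.2⟩⟩)
    (fun a b hab => Subtype.ext (Subtype.ext (congrArg
      (fun z : {x // x ∈ G.edgeFinset.erase (e : Sym2 V)} => (z : Sym2 V)) hab)))
  rw [MvPolynomial.aeval_rename] at hf
  rw [hind'.eq_zero_of_aeval_eq_zero q hf, map_zero]

/-- In a nontrivial factorization of the tree polynomial the factors would involve disjoint sets of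
variables, so that each would omit some edge; but one of them is a relation between slopes, and the
slopes of all edges but one are algebraically independent. -/
theorem irreducible_of_isSparse {k : Type*} [Field k] (hn : 2 ≤ Fintype.card V)
    (hS : IsSparse G.edgeFinset) : Irreducible (treePolynomial k T o σ) := by
  have hne := treePolynomial_ne_zero_of_isSparse T o σ k hS
  have hE : G.edgeFinset.card + 2 = 2 * Fintype.card V := by
    rw [SimpleGraph.edgeFinset_card]
    exact card_edgeSet_of_equiv σ
  constructor
  · intro hu
    have h1 := (MvPolynomial.isUnit_iff_totalDegree_of_isReduced.1 hu).2
    rw [(isHomogeneous_treePolynomial T o σ k).totalDegree hne] at h1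
    have := T.isSpanningTree.card_add_one
    omega
  · intro f g hfg
    have hf : f ≠ 0 := fun h => hne (by rw [hfg, h, zero_mul])
    have hg : g ≠ 0 := fun h => hne (by rw [hfg, h, mul_zero])
    by_contra! hcon
    have hexists : ∀ p : MvPolynomial G.edgeSet k, p ≠ 0 → ¬ IsUnit p →
        ∃ e, p.degreeOf e ≠ 0 := by
      intro p hp hpu
      by_contra! h
      exact hpu (isUnit_of_degreeOf_eq_zero hp h)
    have hdeg : ∀ e, f.degreeOf e + g.degreeOf e ≤ 1 := fun e => by
      rw [← MvPolynomial.degreeOf_mul_eq hf hg, ← hfg]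
      exact degreeOf_treePolynomial_le T o σ k e
    obtain ⟨a, ha⟩ := hexists f hf hcon.1
    obtain ⟨b, hb⟩ := hexists g hg hcon.2
    have h0 := aeval_coordSlope_treePolynomial T o σ k hn
    rw [hfg, map_mul, mul_eq_zero] at h0
    have hda := hdeg a
    have hdb := hdeg b
    rcases h0 with h0 | h0
    · exact hf (eq_zero_of_aeval_coordSlope hS hE (e := b) (by omega) h0)
    · exact hg (eq_zero_of_aeval_coordSlope hS hE (e := a) (by omega) h0)

end irreducible

end GraphVariety

theorem theorem5p2 {k : Type*} [Field k] [IsAlgClosed k] {V : Type*} [Fintype V]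
    (G : SimpleGraph V) (hconn : G.Connected) (hn : 2 ≤ Fintype.card V)
    (hE : G.edgeSet.ncard = 2 * Fintype.card V - 2)
    (T₀ : SpanningTree G) (o : EdgeOrientation G)
    (σ : {f // f ∈ T₀.edges} ≃ {e // e ∉ T₀.edges}) :
    (∃ ε : Finset G.edgeSet → ℤ,
      (∀ T ∈ coupledTrees G, ε T = 1 ∨ ε T = -1) ∧
      (∀ T ∈ coupledTrees G, ε Tᶜ = (-1) ^ (Fintype.card V - 1) * ε T) ∧
      treePolynomial k T₀ o σ
        = ∑ T ∈ coupledTrees G, (ε T : MvPolynomial G.edgeSet k) * edgeMonomial k T) ∧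
    (∀ P ∈ affinePictureVariety k G, MvPolynomial.eval (slopes P) (treePolynomial k T₀ o σ) = 0) ∧
    (∀ m ∈ affineSlopeVariety k G, MvPolynomial.eval m (treePolynomial k T₀ o σ) = 0) ∧
    (treePolynomial k T₀ o σ ≠ 0 ↔ IsRigidityPseudocircuit G) ∧
    (Irreducible (treePolynomial k T₀ o σ) ↔ IsRigidityCircuit G) ∧
    (∀ G' : G.Subgraph, IsRigidityPseudocircuit G'.coe →
      ∀ (T' : SpanningTree G'.coe) (o' : EdgeOrientation G'.coe)
        (σ' : {f // f ∈ T'.edges} ≃ {e // e ∉ T'.edges}),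
        MvPolynomial.rename G'.hom.mapEdgeSet (treePolynomial k T' o' σ')
          ∣ treePolynomial k T₀ o σ) := by
  have hE' : G.edgeFinset.card + 2 = 2 * Fintype.card V := by
    rw [Set.ncard_eq_toFinset_card' G.edgeSet] at hE
    change G.edgeFinset.card = _ at hE
    omega
  refine ⟨⟨treeSign T₀ o σ, fun T hT => treeSign_coupled T₀ o σ (by simpa [coupledTrees] using hT),
    fun T _ => treeSign_compl T₀ o σ T, treePolynomial_eq_sum T₀ o σ k⟩, ?_,
    fun m hm => eval_eq_zero_of_mem_affineSlopeVariety T₀ o σ hn hm,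
    treePolynomial_ne_zero_iff T₀ o σ k, ?_,
    fun G' hG' T' o' σ' => rename_treePolynomial_dvd T₀ o σ G' hG' T' o' σ'⟩
  · rintro P ⟨hP, -, -, hvert⟩
    exact eval_eq_zero_of_mem_affineSlopeVariety T₀ o σ hn ⟨P, hP, hvert, rfl⟩
  · rw [isRigidityCircuit_iff_isSparse hconn hn hE']
    exact ⟨isSparse_of_irreducible T₀ o σ, irreducible_of_isSparse T₀ o σ hn⟩
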